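/- Let $c>0$ and $\omega\neq 0$ be real constants, and consider the spatial metric $$dl^2 = dr^2+\frac{r^2}{1-\omega^2r^2/c^2}\,d\phi^2+dz^2,\qquad 0<r<c/|\omega|,$$ of the space-time of a uniformly rotating system of reference. Its geodesic equations, parametrized by $s$, are $$\ddot r-\frac{c^4 r}{(c^2-\omega^2r^2)^2}\dot\phi^2=0,\qquad \ddot\phi+\frac{2c^2}{r(c^2-\omega^2r^2)}\dot\phi\,\dot r=0,\qquad \ddot z=0 ,$$ where the dot denotes $d/ds$. Let $D$ be a nonempty connected open subset of $\{(s,r,\phi,z)\in\mathbb R^4 : 0<r<c/|\omega|\}$ (for instance the whole of this set). A smooth vector field $X=\Sigma\,\partial_s+R\,\partial_r+\Phi\,\partial_\phi+Z\,\partial_z$ on $D$ is a Lie point symmetry of the geodesic equations if its second prolongation, applied to each of the equations, vanishes on all second jets over $D$ that satisfy the equations. It is a variational (Noether) symmetry if $\mathrm{pr}^{(1)}X(L)+L\,D_s\Sigma=0$ on all first jets over $D$ with nonzero velocity, where $L=\sqrt{\dot r^2+\frac{r^2}{1-\omega^2r^2/c^2}\dot\phi^2+\dot z^2}$ is the arc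 length Lagrangian, $\mathrm{pr}^{(1)}$ the first prolongation and $D_s$ the total derivative. **Theorem.** (a) The Lie point symmetries of the geodesic equations on $D$ form a Lie algebra $\mathfrak g$ under the commutator of vector fields. It is seven-dimensional, and is spanned by $$\partial_\phi,\quad s\,\partial_s,\quad z\,\partial_s,\quad \partial_s,\quad s\,\partial_z,\quad z\,\partial_z,\quad \partial_z .$$ Its derived algebra $[\mathfrak g,\mathfrak g]$ is five-dimensional and perfect, that is, equal to its own derived algebra; $\mathfrak g$ is neither solvable nor nilpotent. (b) The elements of $\mathfrak g$ that are variational symmetries form a Lie subalgebra $\mathfrak g_v$ of $\mathfrak g$. It is five-dimensional, is spanned by $\partial_\phi,\ s\,\partial_s,\ z\,\partial_s,\ \partial_s,\ \partial_z$, and is solvable but not nilpotent. -/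

import Mathlib

open TopologicalSpace

noncomputable section

namespace RotatingSpace

/-- Spatial coordinates `x = (x 0, x 1, x 2) = (r, φ, z)`. The same type holds velocities
`(ṙ, φ̇, ż)` and accelerations `(r̈, φ̈, z̈)`. -/
abbrev Coord : Type := Fin 3 → ℝ

/-- The space of the independent variable `s` and the dependent variables `x = (r, φ, z)`. -/
abbrev Ext : Type := ℝ × Coord

/-- First jets `(s, x, ẋ)`. -/
abbrev Jet1 : Type := ℝ × Coord × Coord

/-- Second jets `(s, x, ẋ, ẍ)`. -/
abbrev Jet2 : Type := ℝ × Coord × Coord × Coord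

/-! ### Geodesic equations of a metric -/

/-- Partial derivative of `f` with respect to the `k`-th coordinate. -/
def pderiv (k : Fin 3) (f : Coord → ℝ) (x : Coord) : ℝ :=
  fderiv ℝ f x (Pi.single k 1)

/-- The Christoffel symbol `Γ^l_{jk}` of the metric `g`. -/
def christoffel (g : Coord → Matrix (Fin 3) (Fin 3) ℝ) (l j k : Fin 3) (x : Coord) : ℝ :=
  1 / 2 * ∑ m, (g x)⁻¹ l m *
    (pderiv j (fun y => g y m k) x + pderiv k (fun y => g y m j) x - pderiv m (fun y => g y j k) x)

/-- The left-hand side `ẍ^l + Γ^l_{jk} ẋ^j ẋ^k` of the `l`-th geodesic equation, as a function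
on second jets. -/
def geodesicEq (g : Coord → Matrix (Fin 3) (Fin 3) ℝ) (l : Fin 3) (J : Jet2) : ℝ :=
  J.2.2.2 l + ∑ j, ∑ k, christoffel g l j k J.2.1 * J.2.2.1 j * J.2.2.1 k

/-- The arc length Lagrangian `√(g_{ij} ẋ^i ẋ^j)`, as a function on first jets. -/
def arcLength (g : Coord → Matrix (Fin 3) (Fin 3) ℝ) (J : Jet1) : ℝ :=
  Real.sqrt (∑ i, ∑ j, g J.2.1 i j * J.2.2 i * J.2.2 j)

/-- The spatial metric `dl² = dr² + r² / (1 - ω² r² / c²) dφ² + dz²` of the rotating system. -/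
def spatialMetric (c ω : ℝ) (x : Coord) : Matrix (Fin 3) (Fin 3) ℝ :=
  Matrix.diagonal ![1, x 0 ^ 2 / (1 - ω ^ 2 * x 0 ^ 2 / c ^ 2), 1]

/-- On `0 < r < c / |ω|` the geodesic equations of the spatial metric read
`r̈ - c⁴ r / (c² - ω² r²)² φ̇² = 0`, `φ̈ + 2 c² / (r (c² - ω² r²)) φ̇ ṙ = 0`, `z̈ = 0`. -/
theorem geodesicEq_spatialMetric {c ω : ℝ} (hc : 0 < c) (J : Jet2)
    (h0 : 0 < J.2.1 0) (h1 : |ω| * J.2.1 0 < c) :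
    geodesicEq (spatialMetric c ω) 0 J = J.2.2.2 0 -
        c ^ 4 * J.2.1 0 / (c ^ 2 - ω ^ 2 * J.2.1 0 ^ 2) ^ 2 * J.2.2.1 1 ^ 2 ∧
      geodesicEq (spatialMetric c ω) 1 J = J.2.2.2 1 +
        2 * c ^ 2 / (J.2.1 0 * (c ^ 2 - ω ^ 2 * J.2.1 0 ^ 2)) * J.2.2.1 1 * J.2.2.1 0 ∧
      geodesicEq (spatialMetric c ω) 2 J = J.2.2.2 2 := by
  obtain ⟨s, x, v, a⟩ := J
  simp only at h0 h1 ⊢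
  have hlt : 0 < c ^ 2 - ω ^ 2 * x 0 ^ 2 := by
    have h2 : (|ω| * x 0) ^ 2 < c ^ 2 := by
      have : 0 ≤ |ω| * x 0 := by positivity
      gcongr
    rw [mul_pow, sq_abs] at h2
    linarith
  have hne : 1 - ω ^ 2 * x 0 ^ 2 / c ^ 2 ≠ 0 := by
    have : 1 - ω ^ 2 * x 0 ^ 2 / c ^ 2 = (c ^ 2 - ω ^ 2 * x 0 ^ 2) / c ^ 2 := by
      rw [sub_div, div_self (by positivity)]
    rw [this]
    positivity
  have hx : HasFDerivAt (fun y : Coord => y 0) (ContinuousLinearMap.proj (R := ℝ) 0) x :=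
    hasFDerivAt_apply 0 x
  have hf : HasDerivAt (fun r : ℝ => r ^ 2 / (1 - ω ^ 2 * r ^ 2 / c ^ 2))
      (2 * c ^ 4 * x 0 / (c ^ 2 - ω ^ 2 * x 0 ^ 2) ^ 2) (x 0) := by
    have e1 : HasDerivAt (fun r : ℝ => r ^ 2) (2 * x 0) (x 0) := by
      simpa using hasDerivAt_pow 2 (x 0)
    have e2 : HasDerivAt (fun r : ℝ => 1 - ω ^ 2 * r ^ 2 / c ^ 2)
        (-(ω ^ 2 * (2 * x 0) / c ^ 2)) (x 0) :=
      ((e1.const_mul (ω ^ 2)).div_const (c ^ 2)).const_sub 1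
    refine (e1.div e2 hne).congr_deriv ?_
    have : c ^ 2 - ω ^ 2 * x 0 ^ 2 ≠ 0 := hlt.ne'
    have e3 : 1 - ω ^ 2 * x 0 ^ 2 / c ^ 2 = (c ^ 2 - ω ^ 2 * x 0 ^ 2) / c ^ 2 := by
      rw [sub_div, div_self (by positivity)]
    rw [e3]
    field_simp
    ring
  have hF : fderiv ℝ (fun y : Coord => y 0 ^ 2 / (1 - ω ^ 2 * y 0 ^ 2 / c ^ 2)) x =
      (2 * c ^ 4 * x 0 / (c ^ 2 - ω ^ 2 * x 0 ^ 2) ^ 2) •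
        (ContinuousLinearMap.proj (R := ℝ) 0 : Coord →L[ℝ] ℝ) :=
    (HasDerivAt.comp_hasFDerivAt (h₂ := fun r : ℝ => r ^ 2 / (1 - ω ^ 2 * r ^ 2 / c ^ 2)) x hf hx).fderiv
  have hinv : (spatialMetric c ω x)⁻¹ =
      Matrix.diagonal ![1, (x 0 ^ 2 / (1 - ω ^ 2 * x 0 ^ 2 / c ^ 2))⁻¹, 1] := by
    refine Matrix.inv_eq_right_inv ?_
    have h3 : x 0 ^ 2 / (1 - ω ^ 2 * x 0 ^ 2 / c ^ 2) ≠ 0 := div_ne_zero (by positivity) hne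
    rw [spatialMetric, Matrix.diagonal_mul_diagonal, ← Matrix.diagonal_one]
    congr 1
    funext i
    fin_cases i
    · simp
    · exact mul_inv_cancel₀ h3
    · simp
  have hlt' : c ^ 2 - ω ^ 2 * x 0 ^ 2 ≠ 0 := hlt.ne'
  refine ⟨?_, ?_, ?_⟩ <;>
  simp only [geodesicEq, christoffel, hinv, pderiv] <;>
  simp [spatialMetric, Fin.sum_univ_three, Matrix.diagonal_apply, hF]
  · ring
  · field_simp
    ring

section Fields

open scoped ContDiff

/-! ### The Lie algebra of smooth vector fields on an open set -/

/-- Smooth vector fields `Σ ∂_s + R ∂_r + Φ ∂_φ + Z ∂_z` on the open set `D`, each represented by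
its extension by zero outside `D`; the value at `p` is `(Σ, (R, Φ, Z))`. -/
def smoothVectorFields (D : Opens Ext) : Submodule ℝ (Ext → Ext) where
  carrier := {X | ContDiffOn ℝ ∞ X D ∧ ∀ p ∉ D, X p = 0}
  add_mem' := by
    rintro X Y ⟨hX, hX0⟩ ⟨hY, hY0⟩
    exact ⟨hX.add hY, fun p hp => by simp [hX0 p hp, hY0 p hp]⟩
  zero_mem' := ⟨contDiffOn_const, fun _ _ => rfl⟩
  smul_mem' := by
    rintro a X ⟨hX, hX0⟩
    exact ⟨contDiffOn_const.smul hX, fun p hp => by simp [hX0 p hp]⟩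

/-- The type of smooth vector fields on `D`. -/
def VField (D : Opens Ext) : Type := ↥(smoothVectorFields D)

namespace VField

variable {D : Opens Ext}

instance : AddCommGroup (VField D) := inferInstanceAs (AddCommGroup ↥(smoothVectorFields D))

instance : Module ℝ (VField D) := inferInstanceAs (Module ℝ ↥(smoothVectorFields D))

/-- The underlying function of a vector field. -/
def toFun (X : VField D) : Ext → Ext := X.1

theorem ext' {X Y : VField D} (h : ∀ p, X.toFun p = Y.toFun p) : X = Y :=
  Subtype.ext (funext h)

theorem contDiffAt (X : VField D) {p : Ext} (hp : p ∈ D) : ContDiffAt ℝ ∞ X.toFun p :=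
  X.2.1.contDiffAt (D.isOpen.mem_nhds hp)

theorem differentiableAt (X : VField D) {p : Ext} (hp : p ∈ D) :
    DifferentiableAt ℝ X.toFun p :=
  (X.contDiffAt hp).differentiableAt (by simp)

theorem toFun_of_notMem (X : VField D) {p : Ext} (hp : p ∉ D) : X.toFun p = 0 :=
  X.2.2 p hp

theorem toFun_add (X Y : VField D) : (X + Y).toFun = X.toFun + Y.toFun := rfl

theorem toFun_smul (a : ℝ) (X : VField D) : (a • X).toFun = a • X.toFun := rfl

theorem toFun_zero : (0 : VField D).toFun = 0 := rfl

/-- The commutator of vector fields, `[X, Y] = DY (X) - DX (Y)`. -/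
instance : Bracket (VField D) (VField D) where
  bracket X Y := ⟨VectorField.lieBracket ℝ X.toFun Y.toFun, by
    refine ⟨fun p hp => ?_, fun p hp => ?_⟩
    · exact ((X.contDiffAt hp).lieBracket_vectorField (Y.contDiffAt hp)
        (by simp)).contDiffWithinAt
    · exact VectorField.lieBracket_eq_zero_of_eq_zero (X.toFun_of_notMem hp)
        (Y.toFun_of_notMem hp)⟩

theorem toFun_lie (X Y : VField D) :
    ⁅X, Y⁆.toFun = VectorField.lieBracket ℝ X.toFun Y.toFun := rfl

instance : LieRing (VField D) where
  add_lie X Y Z := by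
    refine ext' fun p => ?_
    by_cases hp : p ∈ D
    · simp only [toFun_add, toFun_lie, Pi.add_apply]
      exact VectorField.lieBracket_add_left (X.differentiableAt hp) (Y.differentiableAt hp)
    · rw [toFun_of_notMem _ hp, toFun_of_notMem _ hp]
  lie_add X Y Z := by
    refine ext' fun p => ?_
    by_cases hp : p ∈ D
    · simp only [toFun_add, toFun_lie, Pi.add_apply]
      exact VectorField.lieBracket_add_right (Y.differentiableAt hp) (Z.differentiableAt hp)
    · rw [toFun_of_notMem _ hp, toFun_of_notMem _ hp]
  lie_self X := by
    refine ext' fun p => ?_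
    rw [toFun_lie, VectorField.lieBracket_self, toFun_zero]
  leibniz_lie X Y Z := by
    refine ext' fun p => ?_
    by_cases hp : p ∈ D
    · simp only [toFun_add, toFun_lie, Pi.add_apply]
      exact VectorField.leibniz_identity_lieBracket (n := ∞)
        (by simp only [minSmoothness_of_isRCLikeNormedField]; exact WithTop.coe_le_coe.2 le_top)
        (X.contDiffAt hp) (Y.contDiffAt hp) (Z.contDiffAt hp)
    · rw [toFun_of_notMem _ hp, toFun_of_notMem _ hp]

instance : LieAlgebra ℝ (VField D) where
  lie_smul a X Y := by
    refine ext' fun p => ?_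
    by_cases hp : p ∈ D
    · simp only [toFun_smul, toFun_lie, Pi.smul_apply]
      exact VectorField.lieBracket_const_smul_right (Y.differentiableAt hp)
    · rw [toFun_of_notMem _ hp, toFun_of_notMem _ hp]

open Classical in
/-- The restriction to `D` of a globally defined smooth vector field. -/
def restrict (D : Opens Ext) (X : Ext → Ext) (hX : ContDiff ℝ ∞ X) : VField D :=
  ⟨fun p => if p ∈ D then X p else 0,
    hX.contDiffOn.congr fun p (hp : p ∈ D) => by simp [hp], fun p hp => by simp [hp]⟩

end VField

end Fields

/-! ### Prolongation and symmetries -/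

/-- Total derivative `Ḟ = F_s + F_x ẋ` of a function of `(s, x)`. -/
def totalDeriv (F : Ext → ℝ) (J : Jet1) : ℝ :=
  fderiv ℝ F (J.1, J.2.1) (1, J.2.2)

/-- Second total derivative `F̈ = D_s (Ḟ)` of a function of `(s, x)`, the first total derivative
being a function of `(s, x, ẋ)`. -/
def totalDeriv2 (F : Ext → ℝ) (J : Jet2) : ℝ :=
  fderiv ℝ (totalDeriv F) (J.1, J.2.1, J.2.2.1) (1, J.2.2.1, J.2.2.2)

/-- First prolongation of `X = Σ ∂_s + X^i ∂_{x^i}`: the coefficient of `∂_{ẋ^i}` is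
`Ẋ^i - Σ̇ ẋ^i`. -/
def prolong1 (X : Ext → Ext) (J : Jet1) : Jet1 :=
  ((X (J.1, J.2.1)).1, (X (J.1, J.2.1)).2, fun i =>
    totalDeriv (fun p => (X p).2 i) J - totalDeriv (fun p => (X p).1) J * J.2.2 i)

/-- Second prolongation of `X = Σ ∂_s + X^i ∂_{x^i}`: the coefficient of `∂_{ẍ^i}` is
`Ẍ^i - Σ̈ ẋ^i - 2 Σ̇ ẍ^i`. -/
def prolong2 (X : Ext → Ext) (J : Jet2) : Jet2 :=
  ((X (J.1, J.2.1)).1, (X (J.1, J.2.1)).2,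
    (prolong1 X (J.1, J.2.1, J.2.2.1)).2.2, fun i =>
    totalDeriv2 (fun p => (X p).2 i) J - totalDeriv2 (fun p => (X p).1) J * J.2.2.1 i
      - 2 * totalDeriv (fun p => (X p).1) (J.1, J.2.1, J.2.2.1) * J.2.2.2 i)

/-- `X` is an infinitesimal Lie point symmetry on `D` of the geodesic equations of `g`: the second
prolongation of `X`, applied to each of the equations, vanishes on all second jets over `D` that
satisfy the equations. -/
def IsPointSymmetry (g : Coord → Matrix (Fin 3) (Fin 3) ℝ) {D : Opens Ext} (X : VField D) : Prop :=
  ∀ J : Jet2, (J.1, J.2.1) ∈ D → (∀ l, geodesicEq g l J = 0) →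
    ∀ l, fderiv ℝ (geodesicEq g l) J (prolong2 X.toFun J) = 0

/-- `X` is a variational (Noether) symmetry on `D` of the arc length functional of `g`:
`pr⁽¹⁾X (L) + L · D_s Σ = 0` on all first jets over `D` with nonzero velocity. -/
def IsVariationalSymmetry (g : Coord → Matrix (Fin 3) (Fin 3) ℝ) {D : Opens Ext} (X : VField D) :
    Prop :=
  ∀ J : Jet1, (J.1, J.2.1) ∈ D → J.2.2 ≠ 0 →
    fderiv ℝ (arcLength g) J (prolong1 X.toFun J)
      + arcLength g J * totalDeriv (fun p => (X.toFun p).1) J = 0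

/-! ### The generators -/

/-- `∂_φ` -/
def dPhi (D : Opens Ext) : VField D := .restrict D (fun _ => (0, ![0, 1, 0])) (by fun_prop)

/-- `s ∂_s` -/
def sDs (D : Opens Ext) : VField D := .restrict D (fun p => (p.1, 0)) (by fun_prop)

/-- `z ∂_s` -/
def zDs (D : Opens Ext) : VField D := .restrict D (fun p => (p.2 2, 0)) (by fun_prop)

/-- `∂_s` -/
def dS (D : Opens Ext) : VField D := .restrict D (fun _ => (1, 0)) (by fun_prop)

/-- `s ∂_z` -/
def sDz (D : Opens Ext) : VField D :=
  .restrict D (fun p => (0, p.1 • ![0, 0, 1])) (by fun_prop)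

/-- `z ∂_z` -/
def zDz (D : Opens Ext) : VField D :=
  .restrict D (fun p => (0, p.2 2 • ![0, 0, 1])) (by fun_prop)

/-- `∂_z` -/
def dZ (D : Opens Ext) : VField D := .restrict D (fun _ => (0, ![0, 0, 1])) (by fun_prop)

end RotatingSpace

end

/-! Write h² for the coefficient of dφ², m = c² - ω²r², Q = h'/h (`gammaPhi`) and P = h h'
(`gammaR`). The geodesic equations are r̈ = P φ̇², φ̈ = -2Q ṙ φ̇, z̈ = 0: the metric is a line times
a surface of Gaussian curvature -κ, where κ = Q' + Q² = 3ω²c²/m². The theorem rests on κ being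
nonzero and non-constant in r, which is where ω ≠ 0 enters.

On solutions the acceleration is a function of position and velocity, so the symmetry condition is a
system of polynomial identities of degree at most three in the velocity (`isPointSymmetry_iff`).
Their coefficients (`cubic_coeff_eq_zero`) form an overdetermined linear system for Σ, R, Φ, Z. Σ
and Z have zero covariant Hessian on the curved surfaces s = const, z = const; commuting third
derivatives gives κ F_φ = 0, hence F_φ = F_r = 0 for both (`dirDeriv_eq_zero_of_hessian_eq_zero`).
Commuting third derivatives of Φ gives κ' R + 2κ R_r = 0, which together with R_rr = 0 forces R = 0
(`radial_component_eq_zero`). The remaining coefficients then make Φ constant and Σ, Z affine in s,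
z (`exists_affineField`).

Hence the algebra is the sum of ℝ ∂_φ and the affine vector fields of the (s, z)-plane. Its derived
algebra is sl₂ acting on the translations, which is perfect. Because the arc length is homogeneous
of degree one in the velocity, reparametrizations of s cost nothing; for a field of the algebra, the
variational condition reduces to ż Ż = 0, so Z must be constant
(`isVariationalSymmetry_affineMap_iff`). What remains has an abelian derived algebra inside the span
of z ∂_s and ∂_s. -/

namespace RotatingSpace

/-! ### Directional derivatives of smooth functions -/

/-- The derivative of `F` in the constant direction `u`. -/
noncomputable def dirDeriv (u : Ext) (F : Ext → ℝ) (p : Ext) : ℝ := fderiv ℝ F p u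

/-- The coordinate direction `∂_s`. -/
def eS : Ext := (1, 0)

/-- The coordinate direction `∂_{x^i}`. -/
def eX (i : Fin 3) : Ext := (0, Pi.single i 1)

section Calculus

open scoped ContDiff

/-- `F` is smooth on `D`. -/
abbrev SmoothOn (D : Opens Ext) (F : Ext → ℝ) : Prop := ContDiffOn ℝ ∞ F D

variable {D : Opens Ext} {F G : Ext → ℝ} {p : Ext}

theorem differentiableAt_of_mem (hF : SmoothOn D F) (hp : p ∈ D) :
    DifferentiableAt ℝ F p :=
  (hF.contDiffAt (D.isOpen.mem_nhds hp)).differentiableAt (by simp)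

theorem contDiffOn_fderiv_of_mem (hF : SmoothOn D F) :
    ContDiffOn ℝ ∞ (fderiv ℝ F) D :=
  hF.fderiv_of_isOpen D.isOpen (by simp)

theorem differentiableAt_fderiv (hF : SmoothOn D F) (hp : p ∈ D) :
    DifferentiableAt ℝ (fderiv ℝ F) p :=
  ((contDiffOn_fderiv_of_mem hF).contDiffAt (D.isOpen.mem_nhds hp)).differentiableAt (by simp)

theorem contDiffOn_dirDeriv (hF : SmoothOn D F) (u : Ext) :
    SmoothOn D (dirDeriv u F) :=
  (contDiffOn_fderiv_of_mem hF).clm_apply contDiffOn_const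

/-- Openness of D lets identities that hold only on D be differentiated; the integrability arguments
below repeatedly use this. -/
theorem dirDeriv_congr (h : ∀ q ∈ D, F q = G q) (hp : p ∈ D) (u : Ext) :
    dirDeriv u F p = dirDeriv u G p := by
  have : F =ᶠ[nhds p] G := Filter.eventually_of_mem (D.isOpen.mem_nhds hp) h
  rw [dirDeriv, dirDeriv, this.fderiv_eq]

theorem dirDeriv_const (u : Ext) (a : ℝ) : dirDeriv u (fun _ => a) p = 0 := by
  simp [dirDeriv]

theorem dirDeriv_eq_zero_of_eqOn (h : ∀ q ∈ D, F q = 0) (hp : p ∈ D) (u : Ext) :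
    dirDeriv u F p = 0 := by
  rw [dirDeriv_congr h hp u, dirDeriv_const]

theorem dirDeriv_mul (hF : DifferentiableAt ℝ F p) (hG : DifferentiableAt ℝ G p) (u : Ext) :
    dirDeriv u (fun q => F q * G q) p = F p * dirDeriv u G p + dirDeriv u F p * G p := by
  simp only [dirDeriv, fderiv_fun_mul hF hG]
  simp
  ring

theorem dirDeriv_add (hF : DifferentiableAt ℝ F p) (hG : DifferentiableAt ℝ G p) (u : Ext) :
    dirDeriv u (fun q => F q + G q) p = dirDeriv u F p + dirDeriv u G p := by
  simp [dirDeriv, fderiv_fun_add hF hG]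

theorem dirDeriv_dirDeriv (hF : SmoothOn D F) (hp : p ∈ D) (u w : Ext) :
    dirDeriv u (dirDeriv w F) p = fderiv ℝ (fderiv ℝ F) p u w := by
  have h : HasFDerivAt (dirDeriv w F)
      ((ContinuousLinearMap.apply ℝ ℝ w).comp (fderiv ℝ (fderiv ℝ F) p)) p :=
    (ContinuousLinearMap.apply ℝ ℝ w).hasFDerivAt.comp p
      (differentiableAt_fderiv hF hp).hasFDerivAt
  rw [dirDeriv, h.fderiv]
  rfl

theorem fderiv_fderiv_comm (hF : SmoothOn D F) (hp : p ∈ D) (u w : Ext) :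
    fderiv ℝ (fderiv ℝ F) p u w = fderiv ℝ (fderiv ℝ F) p w u :=
  (hF.contDiffAt (D.isOpen.mem_nhds hp)).isSymmSndFDerivAt
    (by simp only [minSmoothness_of_isRCLikeNormedField]; exact WithTop.coe_le_coe.2 le_top) u w

theorem dirDeriv_comm (hF : SmoothOn D F) (hp : p ∈ D) (u w : Ext) :
    dirDeriv u (dirDeriv w F) p = dirDeriv w (dirDeriv u F) p := by
  rw [dirDeriv_dirDeriv hF hp, dirDeriv_dirDeriv hF hp, fderiv_fderiv_comm hF hp]

theorem dirDeriv_comp_r {f : ℝ → ℝ} {f' : ℝ} (hf : HasDerivAt f f' (p.2 0)) (u : Ext) :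
    dirDeriv u (fun q => f (q.2 0)) p = f' * u.2 0 := by
  have hx : HasFDerivAt (fun q : Ext => q.2 0)
      ((ContinuousLinearMap.proj (R := ℝ) (φ := fun _ : Fin 3 => ℝ) 0).comp
        (ContinuousLinearMap.snd ℝ ℝ Coord)) p :=
    ((ContinuousLinearMap.proj (R := ℝ) (φ := fun _ : Fin 3 => ℝ) 0).comp
        (ContinuousLinearMap.snd ℝ ℝ Coord)).hasFDerivAt
  have h : HasFDerivAt (fun q : Ext => f (q.2 0)) _ p :=
    HasDerivAt.comp_hasFDerivAt (h₂ := f) p hf hx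
  rw [dirDeriv, h.fderiv]
  simp

theorem differentiableAt_comp_r {f : ℝ → ℝ} {f' : ℝ} (hf : HasDerivAt f f' (p.2 0)) :
    DifferentiableAt ℝ (fun q : Ext => f (q.2 0)) p := by
  have : DifferentiableAt ℝ (fun q : Ext => q.2 0) p := by fun_prop
  exact hf.differentiableAt.comp p this

theorem ext_eq_sum (u : Ext) :
    u = u.1 • eS + (u.2 0 • eX 0 + u.2 1 • eX 1 + u.2 2 • eX 2) := by
  refine Prod.ext ?_ (funext fun i => ?_)
  · simp [eS, eX]
  · fin_cases i <;> simp [eS, eX]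

theorem clm_apply_ext {V : Type*} [NormedAddCommGroup V] [NormedSpace ℝ V] (A : Ext →L[ℝ] V)
    (u : Ext) :
    A u = u.1 • A eS + (u.2 0 • A (eX 0) + u.2 1 • A (eX 1) + u.2 2 • A (eX 2)) := by
  conv_lhs => rw [ext_eq_sum u]
  simp only [map_add, map_smul]

theorem fderiv_apply_ext (u : Ext) :
    fderiv ℝ F p u = u.1 * dirDeriv eS F p + (u.2 0 * dirDeriv (eX 0) F p +
      u.2 1 * dirDeriv (eX 1) F p + u.2 2 * dirDeriv (eX 2) F p) :=
  clm_apply_ext _ u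

theorem fderiv_fderiv_apply_self (hF : SmoothOn D F) (hp : p ∈ D) (v : Coord) :
    fderiv ℝ (fderiv ℝ F) p (1, v) (1, v) =
      dirDeriv eS (dirDeriv eS F) p + 2 * v 0 * dirDeriv (eX 0) (dirDeriv eS F) p +
      2 * v 1 * dirDeriv (eX 1) (dirDeriv eS F) p + 2 * v 2 * dirDeriv (eX 2) (dirDeriv eS F) p +
      v 0 ^ 2 * dirDeriv (eX 0) (dirDeriv (eX 0) F) p +
      v 1 ^ 2 * dirDeriv (eX 1) (dirDeriv (eX 1) F) p +
      v 2 ^ 2 * dirDeriv (eX 2) (dirDeriv (eX 2) F) p +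
      2 * (v 0 * v 1) * dirDeriv (eX 0) (dirDeriv (eX 1) F) p +
      2 * (v 0 * v 2) * dirDeriv (eX 0) (dirDeriv (eX 2) F) p +
      2 * (v 1 * v 2) * dirDeriv (eX 1) (dirDeriv (eX 2) F) p := by
  simp only [dirDeriv_dirDeriv hF hp]
  rw [clm_apply_ext (fderiv ℝ (fderiv ℝ F) p) (1, v)]
  simp only [add_apply, smul_apply, smul_eq_mul]
  rw [clm_apply_ext (fderiv ℝ (fderiv ℝ F) p eS) (1, v),
    clm_apply_ext (fderiv ℝ (fderiv ℝ F) p (eX 0)) (1, v),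
    clm_apply_ext (fderiv ℝ (fderiv ℝ F) p (eX 1)) (1, v),
    clm_apply_ext (fderiv ℝ (fderiv ℝ F) p (eX 2)) (1, v),
    fderiv_fderiv_comm hF hp eS (eX 0), fderiv_fderiv_comm hF hp eS (eX 1),
    fderiv_fderiv_comm hF hp eS (eX 2), fderiv_fderiv_comm hF hp (eX 1) (eX 0),
    fderiv_fderiv_comm hF hp (eX 2) (eX 0), fderiv_fderiv_comm hF hp (eX 2) (eX 1)]
  simp only [smul_eq_mul]
  ring

theorem exists_const_of_dirDeriv_eq_zero (hD : IsConnected (D : Set Ext)) (hF : SmoothOn D F)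
    (hs : ∀ q ∈ D, dirDeriv eS F q = 0) (hr : ∀ q ∈ D, dirDeriv (eX 0) F q = 0)
    (hφ : ∀ q ∈ D, dirDeriv (eX 1) F q = 0) (hz : ∀ q ∈ D, dirDeriv (eX 2) F q = 0) :
    ∃ a, ∀ q ∈ D, F q = a := by
  refine D.isOpen.exists_is_const_of_fderiv_eq_zero hD.isPreconnected
    (fun q hq => (differentiableAt_of_mem hF hq).differentiableWithinAt) fun q hq => ?_
  refine ContinuousLinearMap.ext fun u => ?_
  simp [fderiv_apply_ext, hs q hq, hr q hq, hφ q hq, hz q hq]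

/-- A function with vanishing second derivatives on a connected open set is affine there. -/
theorem exists_affine_of_dirDeriv_dirDeriv_eq_zero (hD : IsConnected (D : Set Ext))
    (hF : SmoothOn D F)
    (hss : ∀ q ∈ D, dirDeriv eS (dirDeriv eS F) q = 0)
    (hsz : ∀ q ∈ D, dirDeriv (eX 2) (dirDeriv eS F) q = 0)
    (hzz : ∀ q ∈ D, dirDeriv (eX 2) (dirDeriv (eX 2) F) q = 0)
    (hr : ∀ q ∈ D, dirDeriv (eX 0) F q = 0) (hφ : ∀ q ∈ D, dirDeriv (eX 1) F q = 0) :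
    ∃ a b e : ℝ, ∀ q ∈ D, F q = a * q.1 + b * q.2 2 + e := by
  have swap : ∀ (u w : Ext), (∀ q ∈ D, dirDeriv u F q = 0) →
      ∀ q ∈ D, dirDeriv u (dirDeriv w F) q = 0 := fun u w h q hq => by
    rw [dirDeriv_comm hF hq, dirDeriv_eq_zero_of_eqOn h hq]
  obtain ⟨a, ha⟩ := exists_const_of_dirDeriv_eq_zero hD (contDiffOn_dirDeriv hF _) hss (swap _ _ hr)
    (swap _ _ hφ) hsz
  obtain ⟨b, hb⟩ := exists_const_of_dirDeriv_eq_zero hD (contDiffOn_dirDeriv hF _)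
    (fun q hq => by rw [dirDeriv_comm hF hq, hsz q hq]) (swap _ _ hr) (swap _ _ hφ) hzz
  let ℓ : Ext →L[ℝ] ℝ := (-a) • ContinuousLinearMap.fst ℝ ℝ Coord +
    (-b) • (ContinuousLinearMap.proj (R := ℝ) (φ := fun _ : Fin 3 => ℝ) 2).comp
        (ContinuousLinearMap.snd ℝ ℝ Coord)
  have hd : ∀ q ∈ D, ∀ u, dirDeriv u (fun x => F x + ℓ x) q = dirDeriv u F q + ℓ u := by
    intro q hq u
    rw [dirDeriv_add (differentiableAt_of_mem hF hq) ℓ.differentiableAt]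
    simp [dirDeriv]
  obtain ⟨e, he⟩ := exists_const_of_dirDeriv_eq_zero hD (F := fun x => F x + ℓ x) (hF.add ℓ.contDiff.contDiffOn)
    (fun q hq => by rw [hd q hq, ha q hq]; simp [ℓ, eS])
    (fun q hq => by rw [hd q hq, hr q hq]; simp [ℓ, eX])
    (fun q hq => by rw [hd q hq, hφ q hq]; simp [ℓ, eX])
    (fun q hq => by rw [hd q hq, hb q hq]; simp [ℓ, eX])
  refine ⟨a, b, e, fun q hq => ?_⟩
  rw [← he q hq]
  simp [ℓ]
  ring

end Calculus

/-! ### The determining equations -/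

/-- `Γ^φ_{rφ}` of the spatial metric. -/
noncomputable def gammaPhi (c ω r : ℝ) : ℝ := c ^ 2 / (r * (c ^ 2 - ω ^ 2 * r ^ 2))

/-- The derivative of `gammaPhi`. -/
noncomputable def gammaPhi' (c ω r : ℝ) : ℝ :=
  -(c ^ 2 * (c ^ 2 - 3 * ω ^ 2 * r ^ 2)) / (r * (c ^ 2 - ω ^ 2 * r ^ 2)) ^ 2

/-- `-Γ^r_{φφ}` of the spatial metric. -/
noncomputable def gammaR (c ω r : ℝ) : ℝ := c ^ 4 * r / (c ^ 2 - ω ^ 2 * r ^ 2) ^ 2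

/-! ### The radial coefficient functions and the curvature. -/

section Coefficients

variable {c ω r : ℝ}

theorem sq_sub_pos (hr : 0 < r) (h : |ω| * r < c) : 0 < c ^ 2 - ω ^ 2 * r ^ 2 := by
  have h2 : (|ω| * r) ^ 2 < c ^ 2 := by
    have : 0 ≤ |ω| * r := by positivity
    gcongr
  rw [mul_pow, sq_abs] at h2
  linarith

theorem hasDerivAt_sq_sub : HasDerivAt (fun r => c ^ 2 - ω ^ 2 * r ^ 2) (-(2 * ω ^ 2 * r)) r :=
  (((hasDerivAt_pow 2 r).const_mul (ω ^ 2)).const_sub (c ^ 2)).congr_deriv (by ring)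

theorem hasDerivAt_mul_sq_sub :
    HasDerivAt (fun r => r * (c ^ 2 - ω ^ 2 * r ^ 2)) (c ^ 2 - 3 * ω ^ 2 * r ^ 2) r :=
  ((hasDerivAt_id' r).mul hasDerivAt_sq_sub).congr_deriv (by ring)

theorem hasDerivAt_gammaPhi (hr : r ≠ 0) (hm : c ^ 2 - ω ^ 2 * r ^ 2 ≠ 0) :
    HasDerivAt (gammaPhi c ω) (gammaPhi' c ω r) r :=
  ((hasDerivAt_const r (c ^ 2)).div hasDerivAt_mul_sq_sub (mul_ne_zero hr hm)).congr_deriv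
    (by rw [gammaPhi']; ring)

/-- The derivative is written as κ' - 2 Q Q', with κ = Q' + Q², because only κ and κ' survive in the
integrability condition for the radial component. -/
theorem hasDerivAt_gammaPhi' (hr : r ≠ 0) (hm : c ^ 2 - ω ^ 2 * r ^ 2 ≠ 0) :
    HasDerivAt (gammaPhi' c ω) (12 * ω ^ 4 * c ^ 2 * r / (c ^ 2 - ω ^ 2 * r ^ 2) ^ 3 -
      2 * gammaPhi c ω r * gammaPhi' c ω r) r := by
  have h1 : HasDerivAt (fun r => -(c ^ 2 * (c ^ 2 - 3 * ω ^ 2 * r ^ 2)))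
      (6 * c ^ 2 * ω ^ 2 * r) r :=
    ((((hasDerivAt_pow 2 r).const_mul (3 * ω ^ 2)).const_sub (c ^ 2)).const_mul
      (c ^ 2)).neg.congr_deriv (by ring)
  refine (h1.div (hasDerivAt_mul_sq_sub.pow 2) (pow_ne_zero 2 (mul_ne_zero hr hm))).congr_deriv ?_
  rw [gammaPhi', gammaPhi]
  simp only [Pi.pow_apply]
  field_simp
  ring

/-- Since Q = h'/h, the left side is h''/h, which is minus the Gaussian curvature of the surface.
Its vanishing at ω = 0 reflects the flat case, where there are more symmetries. -/
theorem gammaPhi'_add_sq (hr : r ≠ 0) (hm : c ^ 2 - ω ^ 2 * r ^ 2 ≠ 0) :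
    gammaPhi' c ω r + gammaPhi c ω r ^ 2 = 3 * ω ^ 2 * c ^ 2 / (c ^ 2 - ω ^ 2 * r ^ 2) ^ 2 := by
  rw [gammaPhi', gammaPhi]
  field_simp
  ring

end Coefficients

/-! ### Integrability conditions of the overdetermined systems. -/

section Determining

variable {c ω : ℝ} {D : Opens Ext}

/-- The functions that are affine along the geodesics of the surfaces `s = const`, `z = const` do
not depend on `r` and `φ`. -/
theorem dirDeriv_eq_zero_of_hessian_eq_zero {F : Ext → ℝ} (hc : 0 < c) (hω : ω ≠ 0)
    (hD : ∀ p ∈ D, 0 < p.2 0 ∧ |ω| * p.2 0 < c) (hF : SmoothOn D F)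
    (hrr : ∀ p ∈ D, dirDeriv (eX 0) (dirDeriv (eX 0) F) p = 0)
    (hrφ : ∀ p ∈ D, dirDeriv (eX 0) (dirDeriv (eX 1) F) p =
      gammaPhi c ω (p.2 0) * dirDeriv (eX 1) F p)
    (hφφ : ∀ p ∈ D, dirDeriv (eX 1) (dirDeriv (eX 1) F) p +
      gammaR c ω (p.2 0) * dirDeriv (eX 0) F p = 0) :
    (∀ p ∈ D, dirDeriv (eX 0) F p = 0) ∧ ∀ p ∈ D, dirDeriv (eX 1) F p = 0 := by
  have key : ∀ p ∈ D, dirDeriv (eX 1) F p = 0 := by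
    intro p hp
    have hr := (hD p hp).1
    have hm := sq_sub_pos hr (hD p hp).2
    have hQ := hasDerivAt_gammaPhi (c := c) (ω := ω) hr.ne' hm.ne'
    -- F_rr = 0 gives F_φrr = 0, while differentiating F_rφ = Q F_φ in r gives F_φrr = (Q' + Q²)
    -- F_φ. The factor is a nonzero curvature.
    have e1 : dirDeriv (eX 0) (dirDeriv (eX 0) (dirDeriv (eX 1) F)) p = 0 := by
      rw [dirDeriv_congr (fun q hq => dirDeriv_comm hF hq (eX 0) (eX 1)) hp,
        dirDeriv_comm (contDiffOn_dirDeriv hF _) hp, dirDeriv_eq_zero_of_eqOn hrr hp]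
    rw [dirDeriv_congr hrφ hp, dirDeriv_mul (differentiableAt_comp_r hQ)
      (differentiableAt_of_mem (contDiffOn_dirDeriv hF _) hp), dirDeriv_comp_r hQ, hrφ p hp] at e1
    have e2 : (gammaPhi' c ω (p.2 0) + gammaPhi c ω (p.2 0) ^ 2) * dirDeriv (eX 1) F p = 0 := by
      rw [← e1]; simp [eX]; ring
    rw [gammaPhi'_add_sq hr.ne' hm.ne'] at e2
    exact (mul_eq_zero.1 e2).resolve_left (by positivity)
  refine ⟨fun p hp => ?_, key⟩
  have hr := (hD p hp).1
  have hm := sq_sub_pos hr (hD p hp).2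
  -- As F_φ vanishes on all of D, so does F_φφ, and only P F_r = 0 is left, with P > 0.
  have e := hφφ p hp
  rw [dirDeriv_eq_zero_of_eqOn key hp, zero_add] at e
  exact (mul_eq_zero.1 e).resolve_left (by rw [gammaR]; positivity)

/-- Equating ∂_r Φ_rφ with ∂_φ Φ_rr eliminates Φ and leaves κ' R + 2κ R_r = 0, where κ = Q' + Q².
After division by 6ω²c²/m³ this is the relation `key`, with m = c² - ω²r². -/
theorem radial_component_eq_zero {R Φ : Ext → ℝ} (hc : 0 < c) (hω : ω ≠ 0)
    (hD : ∀ p ∈ D, 0 < p.2 0 ∧ |ω| * p.2 0 < c) (hR : SmoothOn D R)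
    (hΦ : SmoothOn D Φ)
    (hRrr : ∀ p ∈ D, dirDeriv (eX 0) (dirDeriv (eX 0) R) p = 0)
    (hΦrr : ∀ p ∈ D, dirDeriv (eX 0) (dirDeriv (eX 0) Φ) p =
      -2 * gammaPhi c ω (p.2 0) * dirDeriv (eX 0) Φ p)
    (hΦrφ : ∀ p ∈ D, dirDeriv (eX 0) (dirDeriv (eX 1) Φ) p =
      -1 * (gammaPhi' c ω (p.2 0) * R p + gammaPhi c ω (p.2 0) * dirDeriv (eX 0) R p)) :
    ∀ p ∈ D, R p = 0 := by
  have hR' := contDiffOn_dirDeriv hR (eX 0)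
  have key : ∀ p ∈ D, 2 * ω ^ 2 * p.2 0 * R p +
      (c ^ 2 - ω ^ 2 * p.2 0 ^ 2) * dirDeriv (eX 0) R p = 0 := by
    intro p hp
    have hr := (hD p hp).1
    have hm := sq_sub_pos hr (hD p hp).2
    have hQ := hasDerivAt_gammaPhi (c := c) (ω := ω) hr.ne' hm.ne'
    have hQ' := hasDerivAt_gammaPhi' (c := c) (ω := ω) hr.ne' hm.ne'
    have dQ := differentiableAt_comp_r hQ
    have dQ' := differentiableAt_comp_r hQ'
    have dR := differentiableAt_of_mem hR hp
    have dR' := differentiableAt_of_mem hR' hp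
    have e1 : dirDeriv (eX 0) (dirDeriv (eX 0) (dirDeriv (eX 1) Φ)) p =
        dirDeriv (eX 1) (dirDeriv (eX 0) (dirDeriv (eX 0) Φ)) p := by
      rw [dirDeriv_congr (fun q hq => dirDeriv_comm hΦ hq (eX 0) (eX 1)) hp,
        dirDeriv_comm (contDiffOn_dirDeriv hΦ _) hp]
    rw [dirDeriv_congr hΦrr hp, dirDeriv_congr hΦrφ hp,
      dirDeriv_mul (differentiableAt_const _) ((dQ'.fun_mul dR).fun_add (dQ.fun_mul dR')),
      dirDeriv_add (dQ'.fun_mul dR) (dQ.fun_mul dR'), dirDeriv_mul dQ' dR, dirDeriv_mul dQ dR',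
      dirDeriv_mul (dQ.const_mul _)
        (differentiableAt_of_mem (contDiffOn_dirDeriv hΦ _) hp),
      dirDeriv_mul (differentiableAt_const _) dQ,
      dirDeriv_comm hΦ hp, hΦrφ p hp, hRrr p hp, dirDeriv_comp_r hQ, dirDeriv_comp_r hQ,
      dirDeriv_comp_r hQ', dirDeriv_const, dirDeriv_const] at e1
    have h0 : (eX 0).2 0 = 1 := rfl
    have h1 : (eX 1).2 0 = 0 := rfl
    rw [h0, h1] at e1
    have e2 := gammaPhi'_add_sq (c := c) (ω := ω) hr.ne' hm.ne'
    have e3 : 6 * ω ^ 2 * c ^ 2 / (c ^ 2 - ω ^ 2 * p.2 0 ^ 2) ^ 3 * (2 * ω ^ 2 * p.2 0 * R p +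
      (c ^ 2 - ω ^ 2 * p.2 0 ^ 2) * dirDeriv (eX 0) R p) = 0 := by
      have e4 : 3 * ω ^ 2 * c ^ 2 / (c ^ 2 - ω ^ 2 * p.2 0 ^ 2) ^ 2 =
        3 * ω ^ 2 * c ^ 2 * (c ^ 2 - ω ^ 2 * p.2 0 ^ 2) / (c ^ 2 - ω ^ 2 * p.2 0 ^ 2) ^ 3 := by
        field_simp
      rw [e4] at e2
      linear_combination -e1 - 2 * dirDeriv (eX 0) R p * e2
    exact (mul_eq_zero.1 e3).resolve_left (by positivity)
  intro p hp
  -- Differentiate `key` once more in r: the two R_r terms cancel and R_rr = 0, so 2ω² R = 0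
  -- remains.
  have e := dirDeriv_eq_zero_of_eqOn key hp (eX 0)
  have hm := hasDerivAt_sq_sub (c := c) (ω := ω) (r := p.2 0)
  have h1 : HasDerivAt (fun r => 2 * ω ^ 2 * r) (2 * ω ^ 2) (p.2 0) := by
    simpa using (hasDerivAt_id' (p.2 0)).const_mul (2 * ω ^ 2)
  have dm := differentiableAt_comp_r hm
  have d1 := differentiableAt_comp_r h1
  have dR := differentiableAt_of_mem hR hp
  have dR' := differentiableAt_of_mem hR' hp
  rw [dirDeriv_add (d1.fun_mul dR) (dm.fun_mul dR'), dirDeriv_mul d1 dR, dirDeriv_mul dm dR',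
    dirDeriv_comp_r h1, dirDeriv_comp_r hm, hRrr p hp] at e
  have e2 : 2 * ω ^ 2 * R p = 0 := by
    have h0 : (eX 0).2 0 = 1 := rfl
    rw [← e, h0]
    ring
  exact (mul_eq_zero.1 e2).resolve_left (by positivity)

end Determining

/-! ### The symmetry conditions in terms of partial derivatives -/

section Conditions

variable {c ω : ℝ} {D : Opens Ext}

/-- The total derivative pairs the differential of F at (s, x) with (1, v). The product rule gives a
Hessian term from the moving base point and a first-order term from the moving velocity. -/
theorem totalDeriv2_eq {F : Ext → ℝ} (hF : SmoothOn D F) {s : ℝ} {x : Coord} (hp : (s, x) ∈ D)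
    (v a : Coord) :
    totalDeriv2 F (s, x, v, a) =
      fderiv ℝ (fderiv ℝ F) (s, x) (1, v) (1, v) + fderiv ℝ F (s, x) (0, a) := by
  let A : Jet1 →L[ℝ] Ext := (ContinuousLinearMap.fst ℝ ℝ (Coord × Coord)).prod
    ((ContinuousLinearMap.fst ℝ Coord Coord).comp (ContinuousLinearMap.snd ℝ ℝ (Coord × Coord)))
  let B : Jet1 →L[ℝ] Ext := (0 : Jet1 →L[ℝ] ℝ).prod
    ((ContinuousLinearMap.snd ℝ Coord Coord).comp (ContinuousLinearMap.snd ℝ ℝ (Coord × Coord)))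
  have h1 : HasFDerivAt (fun J : Jet1 => fderiv ℝ F (A J))
      ((fderiv ℝ (fderiv ℝ F) (s, x)).comp A) (s, x, v) :=
    HasFDerivAt.comp (g := fderiv ℝ F) (s, x, v) (differentiableAt_fderiv hF hp).hasFDerivAt
      A.hasFDerivAt
  have h2 : HasFDerivAt (fun J : Jet1 => ((1, J.2.2) : Ext)) B (s, x, v) := by
    have h3 : (fun J : Jet1 => ((1, J.2.2) : Ext)) = fun J => ((1, 0) : Ext) + B J := by
      funext J
      simp [B]
    rw [h3]
    exact B.hasFDerivAt.const_add _
  have h : HasFDerivAt (totalDeriv F) _ (s, x, v) := h1.clm_apply h2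
  rw [totalDeriv2, h.fderiv]
  simp [A, B, add_comm]

/-- Differentiability suffices: the derivative of `gammaR` only ever multiplies the radial
component, which turns out to vanish. -/
theorem differentiableAt_gammaR {r : ℝ} (hm : c ^ 2 - ω ^ 2 * r ^ 2 ≠ 0) :
    DifferentiableAt ℝ (gammaR c ω) r := by
  unfold gammaR
  exact DifferentiableAt.fun_div (by fun_prop) (by fun_prop) (pow_ne_zero 2 hm)

theorem fderiv_geodesicEq (hc : 0 < c) {s : ℝ} {x v a : Coord} (h0 : 0 < x 0)
    (h1 : |ω| * x 0 < c) (s' : ℝ) (x' v' a' : Coord) :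
    fderiv ℝ (geodesicEq (spatialMetric c ω) 0) (s, x, v, a) (s', x', v', a') =
        a' 0 - deriv (gammaR c ω) (x 0) * x' 0 * v 1 ^ 2 - gammaR c ω (x 0) * (2 * v 1 * v' 1) ∧
      fderiv ℝ (geodesicEq (spatialMetric c ω) 1) (s, x, v, a) (s', x', v', a') =
        a' 1 + 2 * (gammaPhi' c ω (x 0) * x' 0 * v 0 * v 1 +
          gammaPhi c ω (x 0) * (v' 0 * v 1 + v 0 * v' 1)) ∧
      fderiv ℝ (geodesicEq (spatialMetric c ω) 2) (s, x, v, a) (s', x', v', a') = a' 2 := by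
  have hm := sq_sub_pos h0 h1
  have hQ := hasDerivAt_gammaPhi (c := c) (ω := ω) h0.ne' hm.ne'
  have hP := (differentiableAt_gammaR hm.ne').hasDerivAt
  -- The explicit form of the equations holds only for 0 < r < c/|ω|; this set of jets is open, so
  -- the equations may be replaced by that form before differentiating.
  have hU : ∀ᶠ J : Jet2 in nhds (s, x, v, a), 0 < J.2.1 0 ∧ |ω| * J.2.1 0 < c := by
    have o : IsOpen {J : Jet2 | 0 < J.2.1 0 ∧ |ω| * J.2.1 0 < c} :=
      (isOpen_lt (f := fun _ : Jet2 => (0 : ℝ)) (g := fun J => J.2.1 0) (by fun_prop)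
        (by fun_prop)).inter (isOpen_lt (f := fun J : Jet2 => |ω| * J.2.1 0) (g := fun _ => c)
          (by fun_prop) (by fun_prop))
    exact o.mem_nhds ⟨h0, h1⟩
  let π : Jet2 →L[ℝ] Coord × Coord × Coord := ContinuousLinearMap.snd ℝ ℝ _
  let X : Fin 3 → Jet2 →L[ℝ] ℝ := fun i =>
    (ContinuousLinearMap.proj (R := ℝ) (φ := fun _ : Fin 3 => ℝ) i).comp
      ((ContinuousLinearMap.fst ℝ Coord _).comp π)
  let V : Fin 3 → Jet2 →L[ℝ] ℝ := fun i =>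
    (ContinuousLinearMap.proj (R := ℝ) (φ := fun _ : Fin 3 => ℝ) i).comp
      ((ContinuousLinearMap.fst ℝ Coord Coord).comp ((ContinuousLinearMap.snd ℝ Coord _).comp π))
  let A : Fin 3 → Jet2 →L[ℝ] ℝ := fun i =>
    (ContinuousLinearMap.proj (R := ℝ) (φ := fun _ : Fin 3 => ℝ) i).comp
      ((ContinuousLinearMap.snd ℝ Coord Coord).comp ((ContinuousLinearMap.snd ℝ Coord _).comp π))
  have hP' := HasDerivAt.comp_hasFDerivAt (h₂ := gammaR c ω) (f := X 0) (s, x, v, a) hP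
    (X 0).hasFDerivAt
  have hQ' := HasDerivAt.comp_hasFDerivAt (h₂ := gammaPhi c ω) (f := X 0) (s, x, v, a) hQ
    (X 0).hasFDerivAt
  have hV := fun i => (V i).hasFDerivAt (x := (s, x, v, a))
  have hA := fun i => (A i).hasFDerivAt (x := (s, x, v, a))
  refine ⟨?_, ?_, ?_⟩
  · have e : geodesicEq (spatialMetric c ω) 0 =ᶠ[nhds (s, x, v, a)]
        fun J => A 0 J - (gammaR c ω ∘ X 0) J * (V 1 J * V 1 J) := hU.mono fun J hJ => by
      rw [(geodesicEq_spatialMetric hc J hJ.1 hJ.2).1]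
      simp [A, X, V, π, gammaR, sq]
    rw [e.fderiv_eq, ((hA 0).fun_sub (hP'.fun_mul ((hV 1).fun_mul (hV 1)))).fderiv]
    simp [A, X, V, π]
    ring
  · have e : geodesicEq (spatialMetric c ω) 1 =ᶠ[nhds (s, x, v, a)]
        fun J => A 1 J + (gammaPhi c ω ∘ X 0) J * (V 0 J * V 1 J) * 2 := hU.mono fun J hJ => by
      rw [(geodesicEq_spatialMetric hc J hJ.1 hJ.2).2.1]
      simp [A, X, V, π, gammaPhi]
      ring
    rw [e.fderiv_eq, ((hA 1).fun_add ((hQ'.fun_mul ((hV 0).fun_mul (hV 1))).mul_const 2)).fderiv]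
    simp [A, X, V, π]
    ring
  · have e : geodesicEq (spatialMetric c ω) 2 =ᶠ[nhds (s, x, v, a)] A 2 := hU.mono fun J hJ => by
      rw [(geodesicEq_spatialMetric hc J hJ.1 hJ.2).2.2]
      simp [A, π]
    rw [e.fderiv_eq, (hA 2).fderiv]
    simp [A, π]

namespace VField

/-- The component `Σ` of a vector field. -/
def sComp (X : VField D) (p : Ext) : ℝ := (X.toFun p).1

/-- The component of a vector field in the direction `∂_{x^i}`. -/
def xComp (X : VField D) (i : Fin 3) (p : Ext) : ℝ := (X.toFun p).2 i

theorem smoothOn_sComp (X : VField D) : SmoothOn D X.sComp := X.2.1.fst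

theorem smoothOn_xComp (X : VField D) (i : Fin 3) : SmoothOn D (X.xComp i) :=
  contDiffOn_pi.1 X.2.1.snd i

end VField

/-- The acceleration of a geodesic with the given radius and velocity. -/
noncomputable def geodesicAcc (c ω r : ℝ) (v : Coord) : Coord :=
  ![gammaR c ω r * v 1 ^ 2, -(2 * gammaPhi c ω r * v 0 * v 1), 0]

/-- The second derivative of `F` along a geodesic. -/
noncomputable def geodesicDeriv2 (c ω : ℝ) (F : Ext → ℝ) (p : Ext) (v : Coord) : ℝ :=
  fderiv ℝ (fderiv ℝ F) p (1, v) (1, v) + fderiv ℝ F p (0, geodesicAcc c ω (p.2 0) v)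

/-- The second prolongation of `X`, applied to the geodesic equations, vanishes at the jet over `p`
with velocity `v` that satisfies them. -/
def DeterminingEqs (c ω : ℝ) (X : VField D) (p : Ext) (v : Coord) : Prop :=
  (geodesicDeriv2 c ω (X.xComp 0) p v - geodesicDeriv2 c ω X.sComp p v * v 0 -
      deriv (gammaR c ω) (p.2 0) * X.xComp 0 p * v 1 ^ 2 -
      2 * gammaR c ω (p.2 0) * v 1 * fderiv ℝ (X.xComp 1) p (1, v) = 0) ∧
    (geodesicDeriv2 c ω (X.xComp 1) p v - geodesicDeriv2 c ω X.sComp p v * v 1 +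
      2 * gammaPhi' c ω (p.2 0) * X.xComp 0 p * v 0 * v 1 +
      2 * gammaPhi c ω (p.2 0) * (v 1 * fderiv ℝ (X.xComp 0) p (1, v) +
        v 0 * fderiv ℝ (X.xComp 1) p (1, v)) = 0) ∧
    geodesicDeriv2 c ω (X.xComp 2) p v - geodesicDeriv2 c ω X.sComp p v * v 2 = 0

/-- On solutions the acceleration equals `geodesicAcc`, leaving position and velocity free. The
terms with the first total derivative of Σ cancel, since the equations are quadratic in the velocity
and the prolongation scales acceleration twice as fast as velocity. Hence Σ enters only through its
second derivative along the geodesic. -/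
theorem isPointSymmetry_iff (hc : 0 < c) (hD : ∀ p ∈ D, 0 < p.2 0 ∧ |ω| * p.2 0 < c)
    (X : VField D) :
    IsPointSymmetry (spatialMetric c ω) X ↔
      ∀ p ∈ D, ∀ v, DeterminingEqs c ω X p v := by
  have key : ∀ (s : ℝ) (x v : Coord), (s, x) ∈ D → ∀ i,
      (prolong2 X.toFun (s, x, v, geodesicAcc c ω (x 0) v)).2.2.2 i =
      geodesicDeriv2 c ω (X.xComp i) (s, x) v - geodesicDeriv2 c ω X.sComp (s, x) v * v i -
        2 * fderiv ℝ X.sComp (s, x) (1, v) * geodesicAcc c ω (x 0) v i := by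
    intro s x v hp i
    change totalDeriv2 (X.xComp i) (s, x, v, geodesicAcc c ω (x 0) v) -
      totalDeriv2 X.sComp (s, x, v, geodesicAcc c ω (x 0) v) * v i -
      2 * totalDeriv X.sComp (s, x, v) * geodesicAcc c ω (x 0) v i = _
    rw [totalDeriv2_eq (X.smoothOn_xComp i) hp, totalDeriv2_eq X.smoothOn_sComp hp]
    rfl
  have key1 : ∀ (s : ℝ) (x v a : Coord) i, (prolong2 X.toFun (s, x, v, a)).2.2.1 i =
      fderiv ℝ (X.xComp i) (s, x) (1, v) - fderiv ℝ X.sComp (s, x) (1, v) * v i :=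
    fun _ _ _ _ _ => rfl
  have key0 : ∀ (s : ℝ) (x v a : Coord) i, (prolong2 X.toFun (s, x, v, a)).2.1 i =
      X.xComp i (s, x) := fun _ _ _ _ _ => rfl
  have main : ∀ (s : ℝ) (x v : Coord), (s, x) ∈ D →
      ((∀ l, fderiv ℝ (geodesicEq (spatialMetric c ω) l) (s, x, v, geodesicAcc c ω (x 0) v)
        (prolong2 X.toFun (s, x, v, geodesicAcc c ω (x 0) v)) = 0) ↔
          DeterminingEqs c ω X (s, x) v) := by
    intro s x v hp
    obtain ⟨h0, h1, h2⟩ := fderiv_geodesicEq hc (s := s) (v := v) (a := geodesicAcc c ω (x 0) v)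
      (hD _ hp).1 (hD _ hp).2 (prolong2 X.toFun (s, x, v, geodesicAcc c ω (x 0) v)).1
      (prolong2 X.toFun (s, x, v, geodesicAcc c ω (x 0) v)).2.1
      (prolong2 X.toFun (s, x, v, geodesicAcc c ω (x 0) v)).2.2.1
      (prolong2 X.toFun (s, x, v, geodesicAcc c ω (x 0) v)).2.2.2
    simp only [Prod.mk.eta] at h0 h1 h2
    rw [key s x v hp, key0, key1] at h0 h1
    rw [key1] at h1
    rw [key s x v hp] at h2
    rw [Fin.forall_fin_succ, Fin.forall_fin_succ, Fin.forall_fin_succ]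
    simp only [Fin.succ_zero_eq_one, Fin.succ_one_eq_two, Fin.forall_fin_zero, and_true]
    refine and_congr (Eq.congr (h0.trans ?_) rfl) (and_congr (Eq.congr (h1.trans ?_) rfl)
      (Eq.congr (h2.trans ?_) rfl))
    · simp [geodesicAcc]
      ring
    · simp [geodesicAcc]
      ring
    · simp [geodesicAcc]
  have onShell : ∀ (s : ℝ) (x v a : Coord), (s, x) ∈ D →
      ((∀ l, geodesicEq (spatialMetric c ω) l (s, x, v, a) = 0) ↔
        a = geodesicAcc c ω (x 0) v) := by
    intro s x v a hp
    have h := geodesicEq_spatialMetric hc (s, x, v, a) (hD _ hp).1 (hD _ hp).2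
    rw [Fin.forall_fin_succ, Fin.forall_fin_succ, Fin.forall_fin_succ]
    simp only [Fin.succ_zero_eq_one, Fin.succ_one_eq_two, Fin.forall_fin_zero, and_true]
    rw [h.1, h.2.1, h.2.2, funext_iff, Fin.forall_fin_succ, Fin.forall_fin_succ,
      Fin.forall_fin_succ]
    simp only [Fin.succ_zero_eq_one, Fin.succ_one_eq_two, Fin.forall_fin_zero, and_true,
      geodesicAcc, gammaR, gammaPhi]
    refine and_congr ?_ (and_congr ?_ ?_)
    · simp [sub_eq_zero]
    · rw [← sub_eq_zero (a := a 1)]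
      simp only [Matrix.cons_val]
      ring_nf
    · simp
  constructor
  · rintro h ⟨s, x⟩ hp v
    exact (main s x v hp).1 (h _ hp ((onShell s x v _ hp).2 rfl))
  · rintro h ⟨s, x, v, a⟩ hp ha
    obtain rfl := (onShell s x v a hp).1 ha
    exact (main s x v hp).2 (h (s, x) hp v)

end Conditions

/-! ### Solution of the determining equations -/

section Solution

local notation "∂ₛ" => dirDeriv eS
local notation "∂ᵣ" => dirDeriv (eX 0)
local notation "∂ᵩ" => dirDeriv (eX 1)
local notation "∂₃" => dirDeriv (eX 2)

/-- A polynomial of degree at most three in three variables has twenty coefficients. Twenty points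
determine them: the origin, three on each axis, three in each coordinate plane, and (1, 1, 1). -/
theorem cubic_coeff_eq_zero {k l₀ l₁ l₂ q₀₀ q₁₁ q₂₂ q₀₁ q₀₂ q₁₂ t₀₀₀ t₁₁₁ t₂₂₂ t₀₀₁ t₀₀₂ t₀₁₁ t₁₁₂
    t₀₂₂ t₁₂₂ t₀₁₂ : ℝ}
    (h : ∀ a b d : ℝ, k + l₀ * a + l₁ * b + l₂ * d + q₀₀ * a ^ 2 + q₁₁ * b ^ 2 + q₂₂ * d ^ 2 +
      q₀₁ * (a * b) + q₀₂ * (a * d) + q₁₂ * (b * d) + t₀₀₀ * a ^ 3 + t₁₁₁ * b ^ 3 + t₂₂₂ * d ^ 3 +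
      t₀₀₁ * (a ^ 2 * b) + t₀₀₂ * (a ^ 2 * d) + t₀₁₁ * (a * b ^ 2) + t₁₁₂ * (b ^ 2 * d) +
      t₀₂₂ * (a * d ^ 2) + t₁₂₂ * (b * d ^ 2) + t₀₁₂ * (a * b * d) = 0) :
    (k = 0 ∧ l₀ = 0 ∧ l₁ = 0 ∧ l₂ = 0) ∧
    (q₀₀ = 0 ∧ q₁₁ = 0 ∧ q₂₂ = 0 ∧ q₀₁ = 0 ∧ q₀₂ = 0 ∧ q₁₂ = 0) ∧
    (t₀₀₀ = 0 ∧ t₁₁₁ = 0 ∧ t₂₂₂ = 0 ∧ t₀₀₁ = 0 ∧ t₀₀₂ = 0 ∧ t₀₁₁ = 0 ∧ t₁₁₂ = 0 ∧ t₀₂₂ = 0 ∧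
      t₁₂₂ = 0 ∧ t₀₁₂ = 0) := by
  have hk : k = 0 := by simpa using h 0 0 0
  have a1 := h 1 0 0
  have a2 := h (-1) 0 0
  have a3 := h 2 0 0
  have b1 := h 0 1 0
  have b2 := h 0 (-1) 0
  have b3 := h 0 2 0
  have d1 := h 0 0 1
  have d2 := h 0 0 (-1)
  have d3 := h 0 0 2
  have e1 := h 1 1 0
  have e2 := h 1 (-1) 0
  have e3 := h (-1) 1 0
  have f1 := h 1 0 1
  have f2 := h 1 0 (-1)
  have f3 := h (-1) 0 1
  have g1 := h 0 1 1
  have g2 := h 0 1 (-1)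
  have g3 := h 0 (-1) 1
  have i1 := h 1 1 1
  clear h
  subst hk
  norm_num at *
  have h1 : q₀₀ = 0 := by linarith only [a1, a2]
  have h2 : q₁₁ = 0 := by linarith only [b1, b2]
  have h3 : q₂₂ = 0 := by linarith only [d1, d2]
  subst h1 h2 h3
  have h4 : t₀₀₀ = 0 := by linarith only [a1, a3]
  have h5 : t₁₁₁ = 0 := by linarith only [b1, b3]
  have h6 : t₂₂₂ = 0 := by linarith only [d1, d3]
  subst h4 h5 h6
  have h7 : l₀ = 0 := by linarith only [a1]
  have h8 : l₁ = 0 := by linarith only [b1]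
  have h9 : l₂ = 0 := by linarith only [d1]
  subst h7 h8 h9
  have j1 : t₀₀₁ = 0 := by linarith only [e1, e2, e3]
  have j2 : t₀₁₁ = 0 := by linarith only [e1, e2, e3]
  have j3 : t₀₀₂ = 0 := by linarith only [f1, f2, f3]
  have j4 : t₀₂₂ = 0 := by linarith only [f1, f2, f3]
  have j5 : t₁₁₂ = 0 := by linarith only [g1, g2, g3]
  have j6 : t₁₂₂ = 0 := by linarith only [g1, g2, g3]
  subst j1 j2 j3 j4 j5 j6
  have m1 : q₀₁ = 0 := by linarith only [e1]
  have m2 : q₀₂ = 0 := by linarith only [f1]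
  have m3 : q₁₂ = 0 := by linarith only [g1]
  subst m1 m2 m3
  simpa using i1

variable {c ω : ℝ} {D : Opens Ext}

theorem geodesicDeriv2_eq {F : Ext → ℝ} (hF : SmoothOn D F) {p : Ext} (hp : p ∈ D) (v : Coord) :
    geodesicDeriv2 c ω F p v =
      ∂ₛ (∂ₛ F) p + 2 * v 0 * ∂ᵣ (∂ₛ F) p + 2 * v 1 * ∂ᵩ (∂ₛ F) p + 2 * v 2 * ∂₃ (∂ₛ F) p +
      v 0 ^ 2 * ∂ᵣ (∂ᵣ F) p + v 1 ^ 2 * (∂ᵩ (∂ᵩ F) p + gammaR c ω (p.2 0) * ∂ᵣ F p) +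
      v 2 ^ 2 * ∂₃ (∂₃ F) p +
      2 * (v 0 * v 1) * (∂ᵣ (∂ᵩ F) p - gammaPhi c ω (p.2 0) * ∂ᵩ F p) +
      2 * (v 0 * v 2) * ∂ᵣ (∂₃ F) p + 2 * (v 1 * v 2) * ∂ᵩ (∂₃ F) p := by
  rw [geodesicDeriv2, fderiv_fderiv_apply_self hF hp, fderiv_apply_ext]
  simp only [geodesicAcc, Matrix.cons_val]
  ring

variable {X : VField D} {p : Ext}

/-- The coefficients of the third of the determining equations. -/
theorem coeff_axial (hp : p ∈ D) (h : ∀ v, DeterminingEqs c ω X p v) :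
    (∂ₛ (∂ₛ (X.xComp 2)) p = 0 ∧ 2 * ∂₃ (∂ₛ (X.xComp 2)) p - ∂ₛ (∂ₛ X.sComp) p = 0) ∧
    (∂ᵣ (∂ᵣ (X.xComp 2)) p = 0 ∧
      ∂ᵩ (∂ᵩ (X.xComp 2)) p + gammaR c ω (p.2 0) * ∂ᵣ (X.xComp 2) p = 0 ∧
      ∂₃ (∂₃ (X.xComp 2)) p - 2 * ∂₃ (∂ₛ X.sComp) p = 0 ∧
      ∂ᵣ (∂ᵩ (X.xComp 2)) p - gammaPhi c ω (p.2 0) * ∂ᵩ (X.xComp 2) p = 0) ∧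
    (∂ᵣ (∂ᵣ X.sComp) p = 0 ∧ ∂ᵩ (∂ᵩ X.sComp) p + gammaR c ω (p.2 0) * ∂ᵣ X.sComp p = 0 ∧
      ∂₃ (∂₃ X.sComp) p = 0 ∧
      ∂ᵣ (∂ᵩ X.sComp) p - gammaPhi c ω (p.2 0) * ∂ᵩ X.sComp p = 0) := by
  obtain ⟨⟨h1, -, -, h2⟩, ⟨h3, h4, h5, h6, -, -⟩, ⟨-, -, h7, -, h8, -, h9, -, -, h10⟩⟩ :=
    cubic_coeff_eq_zero (k := ∂ₛ (∂ₛ (X.xComp 2)) p) (l₀ := 2 * ∂ᵣ (∂ₛ (X.xComp 2)) p)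
      (l₁ := 2 * ∂ᵩ (∂ₛ (X.xComp 2)) p)
      (l₂ := 2 * ∂₃ (∂ₛ (X.xComp 2)) p - ∂ₛ (∂ₛ X.sComp) p) (q₀₀ := ∂ᵣ (∂ᵣ (X.xComp 2)) p)
      (q₁₁ := ∂ᵩ (∂ᵩ (X.xComp 2)) p + gammaR c ω (p.2 0) * ∂ᵣ (X.xComp 2) p)
      (q₂₂ := ∂₃ (∂₃ (X.xComp 2)) p - 2 * ∂₃ (∂ₛ X.sComp) p)
      (q₀₁ := 2 * (∂ᵣ (∂ᵩ (X.xComp 2)) p - gammaPhi c ω (p.2 0) * ∂ᵩ (X.xComp 2) p))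
      (q₀₂ := 2 * ∂ᵣ (∂₃ (X.xComp 2)) p - 2 * ∂ᵣ (∂ₛ X.sComp) p)
      (q₁₂ := 2 * ∂ᵩ (∂₃ (X.xComp 2)) p - 2 * ∂ᵩ (∂ₛ X.sComp) p)
      (t₀₀₀ := 0) (t₁₁₁ := 0) (t₂₂₂ := -∂₃ (∂₃ X.sComp) p) (t₀₀₁ := 0)
      (t₀₀₂ := -∂ᵣ (∂ᵣ X.sComp) p) (t₀₁₁ := 0)
      (t₁₁₂ := -(∂ᵩ (∂ᵩ X.sComp) p + gammaR c ω (p.2 0) * ∂ᵣ X.sComp p))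
      (t₀₂₂ := -2 * ∂ᵣ (∂₃ X.sComp) p) (t₁₂₂ := -2 * ∂ᵩ (∂₃ X.sComp) p)
      (t₀₁₂ := -2 * (∂ᵣ (∂ᵩ X.sComp) p - gammaPhi c ω (p.2 0) * ∂ᵩ X.sComp p))
      (fun a b d => by
        have e := (h ![a, b, d]).2.2
        rw [geodesicDeriv2_eq (X.smoothOn_xComp 2) hp, geodesicDeriv2_eq X.smoothOn_sComp hp] at e
        simp only [Matrix.cons_val] at e
        linear_combination e)
  refine ⟨⟨h1, h2⟩, ⟨h3, h4, h5, ?_⟩, ?_, ?_, ?_, ?_⟩ <;> linarith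

/-- The coefficients of the first of the determining equations. -/
theorem coeff_radial (hp : p ∈ D) (h : ∀ v, DeterminingEqs c ω X p v) :
    2 * ∂ᵣ (∂ₛ (X.xComp 0)) p - ∂ₛ (∂ₛ X.sComp) p = 0 ∧
    ∂ᵩ (∂ₛ (X.xComp 0)) p - gammaR c ω (p.2 0) * ∂ₛ (X.xComp 1) p = 0 ∧
    ∂ᵣ (∂ᵣ (X.xComp 0)) p - 2 * ∂ᵣ (∂ₛ X.sComp) p = 0 ∧
    ∂ᵩ (∂ᵩ (X.xComp 0)) p + gammaR c ω (p.2 0) * ∂ᵣ (X.xComp 0) p -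
      deriv (gammaR c ω) (p.2 0) * X.xComp 0 p -
      2 * gammaR c ω (p.2 0) * ∂ᵩ (X.xComp 1) p = 0 ∧
    ∂ᵣ (∂ᵩ (X.xComp 0)) p - gammaPhi c ω (p.2 0) * ∂ᵩ (X.xComp 0) p -
      gammaR c ω (p.2 0) * ∂ᵣ (X.xComp 1) p - ∂ᵩ (∂ₛ X.sComp) p = 0 ∧
    ∂ᵣ (∂₃ (X.xComp 0)) p - ∂₃ (∂ₛ X.sComp) p = 0 ∧
    ∂ᵩ (∂₃ (X.xComp 0)) p - gammaR c ω (p.2 0) * ∂₃ (X.xComp 1) p = 0 := by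
  obtain ⟨⟨-, h1, h2, -⟩, ⟨h3, h4, -, h5, h6, h7⟩, -⟩ :=
    cubic_coeff_eq_zero (k := ∂ₛ (∂ₛ (X.xComp 0)) p)
      (l₀ := 2 * ∂ᵣ (∂ₛ (X.xComp 0)) p - ∂ₛ (∂ₛ X.sComp) p)
      (l₁ := 2 * (∂ᵩ (∂ₛ (X.xComp 0)) p - gammaR c ω (p.2 0) * ∂ₛ (X.xComp 1) p))
      (l₂ := 2 * ∂₃ (∂ₛ (X.xComp 0)) p)
      (q₀₀ := ∂ᵣ (∂ᵣ (X.xComp 0)) p - 2 * ∂ᵣ (∂ₛ X.sComp) p)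
      (q₁₁ := ∂ᵩ (∂ᵩ (X.xComp 0)) p + gammaR c ω (p.2 0) * ∂ᵣ (X.xComp 0) p -
        deriv (gammaR c ω) (p.2 0) * X.xComp 0 p -
        2 * gammaR c ω (p.2 0) * ∂ᵩ (X.xComp 1) p)
      (q₂₂ := ∂₃ (∂₃ (X.xComp 0)) p)
      (q₀₁ := 2 * (∂ᵣ (∂ᵩ (X.xComp 0)) p - gammaPhi c ω (p.2 0) * ∂ᵩ (X.xComp 0) p -
        gammaR c ω (p.2 0) * ∂ᵣ (X.xComp 1) p - ∂ᵩ (∂ₛ X.sComp) p))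
      (q₀₂ := 2 * (∂ᵣ (∂₃ (X.xComp 0)) p - ∂₃ (∂ₛ X.sComp) p))
      (q₁₂ := 2 * (∂ᵩ (∂₃ (X.xComp 0)) p - gammaR c ω (p.2 0) * ∂₃ (X.xComp 1) p))
      (t₀₀₀ := -∂ᵣ (∂ᵣ X.sComp) p) (t₁₁₁ := 0) (t₂₂₂ := 0)
      (t₀₀₁ := -2 * (∂ᵣ (∂ᵩ X.sComp) p - gammaPhi c ω (p.2 0) * ∂ᵩ X.sComp p))
      (t₀₀₂ := -2 * ∂ᵣ (∂₃ X.sComp) p)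
      (t₀₁₁ := -(∂ᵩ (∂ᵩ X.sComp) p + gammaR c ω (p.2 0) * ∂ᵣ X.sComp p)) (t₁₁₂ := 0)
      (t₀₂₂ := -∂₃ (∂₃ X.sComp) p) (t₁₂₂ := 0) (t₀₁₂ := -2 * ∂ᵩ (∂₃ X.sComp) p)
      (fun a b d => by
        have e := (h ![a, b, d]).1
        rw [geodesicDeriv2_eq (X.smoothOn_xComp 0) hp, geodesicDeriv2_eq X.smoothOn_sComp hp,
          fderiv_apply_ext] at e
        simp only [Matrix.cons_val] at e
        linear_combination e)
  refine ⟨h1, ?_, h3, h4, ?_, ?_, ?_⟩ <;> linarith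

/-- The coefficients of the second of the determining equations. -/
theorem coeff_angular (hp : p ∈ D) (h : ∀ v, DeterminingEqs c ω X p v) :
    ∂ᵣ (∂ᵣ (X.xComp 1)) p + 2 * gammaPhi c ω (p.2 0) * ∂ᵣ (X.xComp 1) p = 0 ∧
    ∂ᵣ (∂ᵩ (X.xComp 1)) p + (gammaPhi' c ω (p.2 0) * X.xComp 0 p +
      gammaPhi c ω (p.2 0) * ∂ᵣ (X.xComp 0) p) - ∂ᵣ (∂ₛ X.sComp) p = 0 := by
  obtain ⟨-, ⟨h1, -, -, h2, -, -⟩, -⟩ :=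
    cubic_coeff_eq_zero (k := ∂ₛ (∂ₛ (X.xComp 1)) p)
      (l₀ := 2 * ∂ᵣ (∂ₛ (X.xComp 1)) p + 2 * gammaPhi c ω (p.2 0) * ∂ₛ (X.xComp 1) p)
      (l₁ := 2 * ∂ᵩ (∂ₛ (X.xComp 1)) p - ∂ₛ (∂ₛ X.sComp) p +
        2 * gammaPhi c ω (p.2 0) * ∂ₛ (X.xComp 0) p)
      (l₂ := 2 * ∂₃ (∂ₛ (X.xComp 1)) p)
      (q₀₀ := ∂ᵣ (∂ᵣ (X.xComp 1)) p + 2 * gammaPhi c ω (p.2 0) * ∂ᵣ (X.xComp 1) p)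
      (q₁₁ := ∂ᵩ (∂ᵩ (X.xComp 1)) p + gammaR c ω (p.2 0) * ∂ᵣ (X.xComp 1) p +
        2 * gammaPhi c ω (p.2 0) * ∂ᵩ (X.xComp 0) p - 2 * ∂ᵩ (∂ₛ X.sComp) p)
      (q₂₂ := ∂₃ (∂₃ (X.xComp 1)) p)
      (q₀₁ := 2 * (∂ᵣ (∂ᵩ (X.xComp 1)) p + (gammaPhi' c ω (p.2 0) * X.xComp 0 p +
        gammaPhi c ω (p.2 0) * ∂ᵣ (X.xComp 0) p) - ∂ᵣ (∂ₛ X.sComp) p))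
      (q₀₂ := 2 * ∂ᵣ (∂₃ (X.xComp 1)) p + 2 * gammaPhi c ω (p.2 0) * ∂₃ (X.xComp 1) p)
      (q₁₂ := 2 * ∂ᵩ (∂₃ (X.xComp 1)) p - 2 * ∂₃ (∂ₛ X.sComp) p +
        2 * gammaPhi c ω (p.2 0) * ∂₃ (X.xComp 0) p)
      (t₀₀₀ := 0) (t₁₁₁ := -(∂ᵩ (∂ᵩ X.sComp) p + gammaR c ω (p.2 0) * ∂ᵣ X.sComp p)) (t₂₂₂ := 0)
      (t₀₀₁ := -∂ᵣ (∂ᵣ X.sComp) p) (t₀₀₂ := 0)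
      (t₀₁₁ := -2 * (∂ᵣ (∂ᵩ X.sComp) p - gammaPhi c ω (p.2 0) * ∂ᵩ X.sComp p))
      (t₁₁₂ := -2 * ∂ᵩ (∂₃ X.sComp) p) (t₀₂₂ := 0) (t₁₂₂ := -∂₃ (∂₃ X.sComp) p)
      (t₀₁₂ := -2 * ∂ᵣ (∂₃ X.sComp) p)
      (fun a b d => by
        have e := (h ![a, b, d]).2.1
        rw [geodesicDeriv2_eq (X.smoothOn_xComp 1) hp, geodesicDeriv2_eq X.smoothOn_sComp hp,
          fderiv_apply_ext, fderiv_apply_ext] at e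
        simp only [Matrix.cons_val] at e
        linear_combination e)
  exact ⟨h1, by linarith⟩

/-- The vector field `f ∂_φ + (a s + b z + e) ∂_s + (α s + β z + γ) ∂_z`, where `k` is the list of
`f, a, b, e, α, β, γ`. -/
def affineField (k : Fin 7 → ℝ) (p : Ext) : Ext :=
  (k 1 * p.1 + k 2 * p.2 2 + k 3, ![0, k 0, k 4 * p.1 + k 5 * p.2 2 + k 6])

/-- The Hessian conditions for Σ and Z remove their dependence on r and φ. This frees the equations
for R and Φ of Σ and yields R = 0. The radial equation with R = 0 then kills every first derivative
of Φ, using P ≠ 0, and the second derivatives Σ_ss and Σ_sz; the axial equation does the rest. -/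
theorem exists_affineField (hc : 0 < c) (hω : ω ≠ 0) (hconn : IsConnected (D : Set Ext))
    (hD : ∀ p ∈ D, 0 < p.2 0 ∧ |ω| * p.2 0 < c) (hX : IsPointSymmetry (spatialMetric c ω) X) :
    ∃ k, ∀ p ∈ D, X.toFun p = affineField k p := by
  rw [isPointSymmetry_iff hc hD] at hX
  have hZ := fun p hp => coeff_axial hp (hX p hp)
  have hR := fun p hp => coeff_radial hp (hX p hp)
  have hΦ := fun p hp => coeff_angular hp (hX p hp)
  have sS := X.smoothOn_sComp
  have sR := X.smoothOn_xComp 0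
  have sΦ := X.smoothOn_xComp 1
  have sZ := X.smoothOn_xComp 2
  obtain ⟨Sr, Sφ⟩ := dirDeriv_eq_zero_of_hessian_eq_zero hc hω hD sS
    (fun p hp => (hZ p hp).2.2.1) (fun p hp => sub_eq_zero.1 (hZ p hp).2.2.2.2.2)
    (fun p hp => (hZ p hp).2.2.2.1)
  obtain ⟨Zr, Zφ⟩ := dirDeriv_eq_zero_of_hessian_eq_zero hc hω hD sZ
    (fun p hp => (hZ p hp).2.1.1) (fun p hp => sub_eq_zero.1 (hZ p hp).2.1.2.2.2)
    (fun p hp => (hZ p hp).2.1.2.1)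
  have Ssr : ∀ p ∈ D, ∂ᵣ (∂ₛ X.sComp) p = 0 := fun p hp => by
    rw [dirDeriv_comm sS hp, dirDeriv_eq_zero_of_eqOn Sr hp]
  have R0 := radial_component_eq_zero hc hω hD sR sΦ
    (fun p hp => by linarith [(hR p hp).2.2.1, Ssr p hp])
    (fun p hp => by linarith [(hΦ p hp).1])
    (fun p hp => by linarith [(hΦ p hp).2, Ssr p hp])
  have dR : ∀ u, ∀ p ∈ D, dirDeriv u (X.xComp 0) p = 0 := fun u p hp =>
    dirDeriv_eq_zero_of_eqOn R0 hp u
  have ddR : ∀ u w, ∀ p ∈ D, dirDeriv u (dirDeriv w (X.xComp 0)) p = 0 := fun u w p hp =>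
    dirDeriv_eq_zero_of_eqOn (dR w) hp u
  have P0 : ∀ p ∈ D, gammaR c ω (p.2 0) ≠ 0 := fun p hp => by
    have h0 := (hD p hp).1
    have hm := sq_sub_pos h0 (hD p hp).2
    rw [gammaR]
    positivity
  -- The radial coefficients give Σ_ss = 2 R_rs and Σ_sz = R_rz. So R = 0 excludes the quadratic
  -- projective fields of the (s, z)-plane and leaves only affine ones.
  have Sss : ∀ p ∈ D, ∂ₛ (∂ₛ X.sComp) p = 0 := fun p hp => by
    linarith [(hR p hp).1, ddR (eX 0) eS p hp]
  have Ssz : ∀ p ∈ D, ∂₃ (∂ₛ X.sComp) p = 0 := fun p hp => by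
    linarith [(hR p hp).2.2.2.2.2.1, ddR (eX 0) (eX 2) p hp]
  have Ssφ : ∀ p ∈ D, ∂ᵩ (∂ₛ X.sComp) p = 0 := fun p hp => by
    rw [dirDeriv_comm sS hp, dirDeriv_eq_zero_of_eqOn Sφ hp]
  have Φs : ∀ p ∈ D, ∂ₛ (X.xComp 1) p = 0 := fun p hp =>
    (mul_eq_zero.1 (by linarith [(hR p hp).2.1, ddR (eX 1) eS p hp])).resolve_left (P0 p hp)
  have Φz : ∀ p ∈ D, ∂₃ (X.xComp 1) p = 0 := fun p hp =>
    (mul_eq_zero.1 (by linarith [(hR p hp).2.2.2.2.2.2, ddR (eX 1) (eX 2) p hp])).resolve_left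
      (P0 p hp)
  have Φr : ∀ p ∈ D, ∂ᵣ (X.xComp 1) p = 0 := fun p hp => by
    have h := (hR p hp).2.2.2.2.1
    rw [ddR (eX 0) (eX 1) p hp, dR _ p hp, Ssφ p hp] at h
    exact (mul_eq_zero.1 (by linarith)).resolve_left (P0 p hp)
  have Φφ : ∀ p ∈ D, ∂ᵩ (X.xComp 1) p = 0 := fun p hp => by
    have h := (hR p hp).2.2.2.1
    rw [ddR (eX 1) (eX 1) p hp, dR _ p hp, R0 p hp] at h
    exact (mul_eq_zero.1 (by linarith)).resolve_left (P0 p hp)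
  obtain ⟨a, b, e, hS⟩ := exists_affine_of_dirDeriv_dirDeriv_eq_zero hconn sS Sss Ssz
    (fun p hp => (hZ p hp).2.2.2.2.1) Sr Sφ
  obtain ⟨α, β, γ, hZ'⟩ := exists_affine_of_dirDeriv_dirDeriv_eq_zero hconn sZ
    (fun p hp => (hZ p hp).1.1) (fun p hp => by linarith [(hZ p hp).1.2, Sss p hp])
    (fun p hp => by linarith [(hZ p hp).2.1.2.2.1, Ssz p hp]) Zr Zφ
  obtain ⟨f, hf⟩ := exists_const_of_dirDeriv_eq_zero hconn sΦ Φs Φr Φφ Φz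
  refine ⟨![f, a, b, e, α, β, γ], fun p hp => Prod.ext (hS p hp) (funext fun i => ?_)⟩
  fin_cases i
  · exact R0 p hp
  · exact hf p hp
  · exact hZ' p hp

end Solution

/-! ### The abstract Lie algebras -/

section LieAlgebras

open Module

variable {L : Type*} [LieRing L] [LieAlgebra ℝ L]

/-- An eigenvector of ad x with nonzero eigenvalue is reproduced by bracketing with x, so it lies in
every term of the lower central series. -/
theorem not_isNilpotent_of_lie_eq_smul {x y : L} {t : ℝ} (ht : t ≠ 0) (hy : y ≠ 0)
    (h : ⁅x, y⁆ = t • y) : ¬ LieRing.IsNilpotent L := by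
  intro hN
  have hN' : LieModule.IsNilpotent L L := hN
  obtain ⟨k, hk⟩ := (LieModule.isNilpotent_iff ℝ L L).1 hN'
  have mem : ∀ n, y ∈ LieModule.lowerCentralSeries ℝ L L n := by
    intro n
    induction n with
    | zero => simp
    | succ n ih =>
      rw [LieModule.lowerCentralSeries_succ]
      have e : y = ⁅t⁻¹ • x, y⁆ := by rw [smul_lie, h, smul_smul, inv_mul_cancel₀ ht, one_smul]
      rw [e]
      exact LieSubmodule.lie_mem_lie (LieSubmodule.mem_top _) ih
  exact hy (by simpa [hk] using mem k)

/-- The bracket of the fields `affineField k` and `affineField l`. -/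
def affineBracket (k l : Fin 7 → ℝ) : Fin 7 → ℝ :=
  ![0, k 4 * l 2 - k 2 * l 4, k 2 * l 1 + k 5 * l 2 - k 1 * l 2 - k 2 * l 5,
    k 3 * l 1 + k 6 * l 2 - k 1 * l 3 - k 2 * l 6, k 1 * l 4 + k 4 * l 5 - k 4 * l 1 - k 5 * l 4,
    k 2 * l 4 - k 4 * l 2, k 3 * l 4 + k 6 * l 5 - k 4 * l 3 - k 5 * l 6]

/-- The first derived ideal of a Lie algebra with bracket `affineBracket`. -/
def tracelessIdeal (e : (Fin 7 → ℝ) ≃ₗ[ℝ] L) (he : ∀ k l, ⁅e k, e l⁆ = e (affineBracket k l)) :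
    LieIdeal ℝ L where
  carrier := {x | e.symm x 0 = 0 ∧ e.symm x 1 + e.symm x 5 = 0}
  add_mem' := by
    rintro x y ⟨h1, h2⟩ ⟨h3, h4⟩
    simp only [Set.mem_ofPred_eq, map_add, Pi.add_apply]
    constructor <;> linarith
  zero_mem' := by simp
  smul_mem' := by
    rintro a x ⟨h1, h2⟩
    simp only [Set.mem_ofPred_eq, map_smul, Pi.smul_apply, smul_eq_mul, ← mul_add, h1, h2]
    simp
  lie_mem := by
    rintro x y -
    obtain ⟨k, rfl⟩ := e.surjective x
    obtain ⟨l, rfl⟩ := e.surjective y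
    rw [he]
    change e.symm (e _) 0 = 0 ∧ e.symm (e _) 1 + e.symm (e _) 5 = 0
    simp [affineBracket]

/-! ### The seven-dimensional algebra ℝ ⊕ aff(2, ℝ). -/

section Full

variable (e : (Fin 7 → ℝ) ≃ₗ[ℝ] L) (he : ∀ k l, ⁅e k, e l⁆ = e (affineBracket k l))

theorem mem_tracelessIdeal (k : Fin 7 → ℝ) :
    e k ∈ tracelessIdeal e he ↔ k 0 = 0 ∧ k 1 + k 5 = 0 := by
  change e.symm (e k) 0 = 0 ∧ e.symm (e k) 1 + e.symm (e k) 5 = 0 ↔ _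
  simp

/-- Commutators of affine fields of the plane have traceless linear part and no ∂_φ component.
Conversely, every such field is a sum of brackets of traceless ones, so both equalities follow from
one chain of inclusions. -/
theorem derivedSeries_one_and_perfect :
    LieAlgebra.derivedSeries ℝ L 1 = tracelessIdeal e he ∧
      ⁅tracelessIdeal e he, tracelessIdeal e he⁆ = tracelessIdeal e he := by
  have h1 : LieAlgebra.derivedSeries ℝ L 1 = ⁅(⊤ : LieIdeal ℝ L), (⊤ : LieIdeal ℝ L)⁆ := rfl
  have h2 : ⁅(⊤ : LieIdeal ℝ L), (⊤ : LieIdeal ℝ L)⁆ ≤ tracelessIdeal e he := by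
    rw [LieSubmodule.lie_le_iff]
    intro x _ y _
    obtain ⟨k, rfl⟩ := e.surjective x
    obtain ⟨l, rfl⟩ := e.surjective y
    rw [he, mem_tracelessIdeal]
    simp [affineBracket]
  have h3 : tracelessIdeal e he ≤ ⁅tracelessIdeal e he, tracelessIdeal e he⁆ := by
    intro x hx
    obtain ⟨k, rfl⟩ := e.surjective x
    rw [mem_tracelessIdeal] at hx
    -- Under ad of s ∂_s - z ∂_z, the fields z ∂_s, ∂_s, s ∂_z, ∂_z have eigenvalues -2, -1, 2, 1;
    -- the entries divide by these. The diagonal part is a multiple of [s ∂_z, z ∂_s] = s ∂_s - z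
    -- ∂_z.
    have : e k = ⁅e ![0, 1, 0, 0, 0, -1, 0], e ![0, 0, -(k 2) / 2, -k 3, k 4 / 2, 0, k 6]⁆ +
        ⁅e ![0, 0, 0, 0, k 1, 0, 0], e ![0, 0, 1, 0, 0, 0, 0]⁆ := by
      rw [he, he, ← map_add]
      congr 1
      ext i
      fin_cases i <;> simp [affineBracket]
      all_goals linarith
    rw [this]
    refine add_mem (LieSubmodule.lie_mem_lie ?_ ?_) (LieSubmodule.lie_mem_lie ?_ ?_) <;>
    simp [mem_tracelessIdeal]
  exact ⟨le_antisymm (h1.trans_le h2) (h3.trans (LieSubmodule.mono_lie le_top le_top)),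
    le_antisymm ((LieSubmodule.mono_lie le_top le_top).trans h2) h3⟩

theorem finrank_tracelessIdeal : finrank ℝ (tracelessIdeal e he) = 5 := by
  let φ : (Fin 5 → ℝ) →ₗ[ℝ] (Fin 7 → ℝ) :=
    { toFun := fun k => ![0, k 0, k 1, k 2, k 3, -k 0, k 4]
      map_add' := fun k l => by ext i; fin_cases i <;> simp [add_comm]
      map_smul' := fun a k => by ext i; fin_cases i <;> simp }
  have hφ : Function.Injective φ := by
    rw [← LinearMap.ker_eq_bot, LinearMap.ker_eq_bot']
    intro k hk
    have h := fun i => congrFun hk i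
    ext i
    fin_cases i
    exacts [h 1, h 2, h 3, h 4, h 6]
  have hr : (tracelessIdeal e he).toSubmodule = LinearMap.range (e.toLinearMap ∘ₗ φ) := by
    ext x
    obtain ⟨k, rfl⟩ := e.surjective x
    rw [LieSubmodule.mem_toSubmodule, mem_tracelessIdeal]
    constructor
    · rintro ⟨h1, h2⟩
      refine ⟨![k 1, k 2, k 3, k 4, k 6], congrArg e ?_⟩
      ext i
      fin_cases i <;> simp [φ, h1]
      linarith
    · rintro ⟨l, hl⟩
      rw [← e.injective hl]
      simp [φ]
  calc finrank ℝ (tracelessIdeal e he) = finrank ℝ (tracelessIdeal e he).toSubmodule := rfl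
    _ = 5 := by
      rw [hr, LinearMap.finrank_range_of_inj (f := e.toLinearMap ∘ₗ φ)
        (e.injective.comp hφ), finrank_fin_fun]

theorem affine_structure (e : (Fin 7 → ℝ) ≃ₗ[ℝ] L)
    (he : ∀ k l, ⁅e k, e l⁆ = e (affineBracket k l)) :
    finrank ℝ (LieAlgebra.derivedSeries ℝ L 1) = 5 ∧
      ⁅LieAlgebra.derivedSeries ℝ L 1, LieAlgebra.derivedSeries ℝ L 1⁆ =
        LieAlgebra.derivedSeries ℝ L 1 ∧
      ¬ LieAlgebra.IsSolvable L ∧ ¬ LieRing.IsNilpotent L := by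
  obtain ⟨h1, h2⟩ := derivedSeries_one_and_perfect e he
  have h3 := finrank_tracelessIdeal e he
  refine ⟨by rw [h1, h3], by rw [h1, h2], fun hS => ?_, ?_⟩
  · obtain ⟨k, hk⟩ := (LieAlgebra.isSolvable_iff ℝ L).1 hS
    have h4 : ∀ n, LieAlgebra.derivedSeries ℝ L (n + 1) = tracelessIdeal e he := by
      intro n
      induction n with
      | zero => exact h1
      | succ n ih =>
        rw [LieAlgebra.derivedSeries_def, LieAlgebra.derivedSeriesOfIdeal_succ,
          ← LieAlgebra.derivedSeries_def, ih, h2]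
    -- The derived series is constant only from index 1 on; passing to k + 1 covers k = 0.
    have h5 : LieAlgebra.derivedSeries ℝ L (k + 1) = ⊥ := by
      rw [LieAlgebra.derivedSeries_def, LieAlgebra.derivedSeriesOfIdeal_succ,
          ← LieAlgebra.derivedSeries_def, hk, LieSubmodule.lie_bot]
    have h6 : e ![0, 0, 1, 0, 0, 0, 0] ∈ (⊥ : LieIdeal ℝ L) := by
      rw [← h5, h4, mem_tracelessIdeal]
      simp
    have h7 := congrFun (e.map_eq_zero_iff.1 ((LieSubmodule.mem_bot _).1 h6)) 2
    simp at h7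
  · refine not_isNilpotent_of_lie_eq_smul (x := e ![0, 1, 0, 0, 0, 0, 0])
      (y := e ![0, 0, 0, 1, 0, 0, 0]) (t := -1) (by norm_num) (fun h => ?_) ?_
    · have h7 := congrFun (e.map_eq_zero_iff.1 h) 3
      simp at h7
    · rw [he, ← map_smul]
      congr 1
      ext i
      fin_cases i <;> simp [affineBracket]

end Full

/-! ### The five-dimensional algebra of variational symmetries. -/

/-- The coefficients of a field `f ∂_φ + (a s + b z + e) ∂_s + γ ∂_z`. -/
def axialTranslation : (Fin 5 → ℝ) →ₗ[ℝ] (Fin 7 → ℝ) where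
  toFun k := ![k 0, k 1, k 2, k 3, 0, 0, k 4]
  map_add' k l := by ext i; fin_cases i <;> simp
  map_smul' a k := by ext i; fin_cases i <;> simp

theorem axialTranslation_injective : Function.Injective axialTranslation := by
  rw [← LinearMap.ker_eq_bot, LinearMap.ker_eq_bot']
  intro k hk
  have h := fun i => congrFun hk i
  ext i
  fin_cases i
  exacts [h 0, h 1, h 2, h 3, h 6]

/-- The bracket of two fields given by `axialTranslation`. -/
def axialBracket (k l : Fin 5 → ℝ) : Fin 5 → ℝ :=
  ![0, 0, k 2 * l 1 - k 1 * l 2, k 3 * l 1 + k 4 * l 2 - k 1 * l 3 - k 2 * l 4, 0]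

theorem affineBracket_axialTranslation (k l : Fin 5 → ℝ) :
    affineBracket (axialTranslation k) (axialTranslation l) =
      axialTranslation (axialBracket k l) := by
  ext i
  fin_cases i <;> simp [affineBracket, axialTranslation, axialBracket]

/-- All brackets lie in the span K of z ∂_s and ∂_s, which is abelian, so the second derived algebra
vanishes. Nilpotency fails because [s ∂_s, ∂_s] = -∂_s. -/
theorem axial_structure (e : (Fin 5 → ℝ) ≃ₗ[ℝ] L)
    (he : ∀ k l, ⁅e k, e l⁆ = e (axialBracket k l)) :
    LieAlgebra.IsSolvable L ∧ ¬ LieRing.IsNilpotent L := by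
  constructor
  · let K : LieIdeal ℝ L :=
      { carrier := {x | e.symm x 0 = 0 ∧ e.symm x 1 = 0 ∧ e.symm x 4 = 0}
        add_mem' := by
          rintro x y ⟨h1, h2, h3⟩ ⟨h4, h5, h6⟩
          simp [h1, h2, h3, h4, h5, h6]
        zero_mem' := by simp
        smul_mem' := by
          rintro a x ⟨h1, h2, h3⟩
          simp [h1, h2, h3]
        lie_mem := by
          rintro x y -
          obtain ⟨k, rfl⟩ := e.surjective x
          obtain ⟨l, rfl⟩ := e.surjective y
          rw [he]
          change e.symm (e _) 0 = 0 ∧ e.symm (e _) 1 = 0 ∧ e.symm (e _) 4 = 0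
          simp [axialBracket] }
    have hK : ∀ k, e k ∈ K ↔ k 0 = 0 ∧ k 1 = 0 ∧ k 4 = 0 := fun k => by
      change e.symm (e k) 0 = 0 ∧ e.symm (e k) 1 = 0 ∧ e.symm (e k) 4 = 0 ↔ _
      simp
    have h1 : LieAlgebra.derivedSeries ℝ L 1 ≤ K := by
      change ⁅(⊤ : LieIdeal ℝ L), (⊤ : LieIdeal ℝ L)⁆ ≤ K
      rw [LieSubmodule.lie_le_iff]
      intro x _ y _
      obtain ⟨k, rfl⟩ := e.surjective x
      obtain ⟨l, rfl⟩ := e.surjective y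
      rw [he, hK]
      simp [axialBracket]
    have h2 : ⁅K, K⁆ ≤ ⊥ := by
      rw [LieSubmodule.lie_le_iff]
      intro x hx y hy
      obtain ⟨k, rfl⟩ := e.surjective x
      obtain ⟨l, rfl⟩ := e.surjective y
      rw [hK] at hx hy
      rw [he, LieSubmodule.mem_bot, e.map_eq_zero_iff]
      ext i
      fin_cases i <;> simp [axialBracket, hx, hy]
    refine (LieAlgebra.isSolvable_iff ℝ L).2 ⟨2, le_bot_iff.1 ?_⟩
    exact (LieSubmodule.mono_lie h1 h1).trans h2
  · refine not_isNilpotent_of_lie_eq_smul (x := e ![0, 1, 0, 0, 0])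
      (y := e ![0, 0, 0, 1, 0]) (t := -1) (by norm_num) (fun h => ?_) ?_
    · have h7 := congrFun (e.map_eq_zero_iff.1 h) 3
      simp at h7
    · rw [he, ← map_smul]
      congr 1
      ext i
      fin_cases i <;> simp [axialBracket]

end LieAlgebras

/-! ### The fields with affine coefficients -/

section AffineFields

variable {c ω : ℝ} {D : Opens Ext}

theorem contDiff_affineField (k : Fin 7 → ℝ) :
    ContDiff ℝ (((⊤ : ℕ∞) : WithTop ℕ∞)) (affineField k) := by
  refine ContDiff.prodMk (by fun_prop) (contDiff_pi.2 fun i => ?_)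
  fin_cases i
  · exact contDiff_const
  · exact contDiff_const
  · exact ((contDiff_const.mul contDiff_fst).add (contDiff_const.mul
      ((contDiff_apply ℝ ℝ (2 : Fin 3)).comp contDiff_snd))).add contDiff_const

theorem VField.toFun_restrict {V : Ext → Ext} (hV : ContDiff ℝ (((⊤ : ℕ∞) : WithTop ℕ∞)) V)
    {p : Ext} (hp : p ∈ D) : (VField.restrict D V hV).toFun p = V p := if_pos hp

theorem VField.eq_of_eqOn {X Y : VField D} (h : ∀ p ∈ D, X.toFun p = Y.toFun p) : X = Y := by
  refine VField.ext' fun p => ?_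
  by_cases hp : p ∈ D
  · exact h p hp
  · rw [X.toFun_of_notMem hp, Y.toFun_of_notMem hp]

/-- The linear map sending a list of coefficients to the restriction of `affineField`. -/
noncomputable def affineMap (D : Opens Ext) : (Fin 7 → ℝ) →ₗ[ℝ] VField D where
  toFun k := .restrict D (affineField k) (contDiff_affineField k)
  map_add' k l := VField.eq_of_eqOn fun p hp => by
    rw [VField.toFun_add, Pi.add_apply, VField.toFun_restrict _ hp, VField.toFun_restrict _ hp,
      VField.toFun_restrict _ hp]
    refine Prod.ext ?_ (funext fun i => ?_)
    · simp [affineField]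
      ring
    · fin_cases i <;> simp [affineField]
      ring
  map_smul' a k := VField.eq_of_eqOn fun p hp => by
    rw [VField.toFun_smul, Pi.smul_apply, VField.toFun_restrict _ hp, VField.toFun_restrict _ hp]
    refine Prod.ext ?_ (funext fun i => ?_)
    · simp [affineField]
      ring
    · fin_cases i <;> simp [affineField]
      ring

theorem toFun_affineMap (k : Fin 7 → ℝ) {p : Ext} (hp : p ∈ D) :
    (affineMap D k).toFun p = affineField k p :=
  VField.toFun_restrict (contDiff_affineField k) hp

theorem affineMap_eq (k : Fin 7 → ℝ) :
    affineMap D k = k 0 • dPhi D + k 1 • sDs D + k 2 • zDs D + k 3 • dS D + k 4 • sDz D +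
      k 5 • zDz D + k 6 • dZ D := by
  refine VField.eq_of_eqOn fun p hp => ?_
  rw [toFun_affineMap k hp]
  simp only [VField.toFun_add, VField.toFun_smul, Pi.add_apply, Pi.smul_apply, dPhi, sDs, zDs, dS,
    sDz, zDz, dZ, VField.toFun_restrict _ hp]
  refine Prod.ext ?_ (funext fun i => ?_)
  · simp [affineField]
  · fin_cases i <;> simp [affineField]

theorem range_affineMap :
    LinearMap.range (affineMap D) =
      Submodule.span ℝ {dPhi D, sDs D, zDs D, dS D, sDz D, zDz D, dZ D} := by
  apply le_antisymm
  · rintro _ ⟨k, rfl⟩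
    rw [affineMap_eq]
    refine add_mem (add_mem (add_mem (add_mem (add_mem (add_mem ?_ ?_) ?_) ?_) ?_) ?_) ?_ <;>
    exact Submodule.smul_mem _ _ (Submodule.subset_span (by simp))
  · rw [Submodule.span_le]
    rintro _ (rfl | rfl | rfl | rfl | rfl | rfl | rfl)
    exacts [⟨![1, 0, 0, 0, 0, 0, 0], by simp [affineMap_eq]⟩,
      ⟨![0, 1, 0, 0, 0, 0, 0], by simp [affineMap_eq]⟩,
      ⟨![0, 0, 1, 0, 0, 0, 0], by simp [affineMap_eq]⟩,
      ⟨![0, 0, 0, 1, 0, 0, 0], by simp [affineMap_eq]⟩,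
      ⟨![0, 0, 0, 0, 1, 0, 0], by simp [affineMap_eq]⟩,
      ⟨![0, 0, 0, 0, 0, 1, 0], by simp [affineMap_eq]⟩,
      ⟨![0, 0, 0, 0, 0, 0, 1], by simp [affineMap_eq]⟩]

theorem range_affineMap_axialTranslation :
    LinearMap.range (affineMap D ∘ₗ axialTranslation) =
      Submodule.span ℝ {dPhi D, sDs D, zDs D, dS D, dZ D} := by
  apply le_antisymm
  · rintro _ ⟨k, rfl⟩
    simp only [LinearMap.comp_apply, affineMap_eq, axialTranslation, LinearMap.coe_mk,
      AddHom.coe_mk, Matrix.cons_val, zero_smul, add_zero]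
    refine add_mem (add_mem (add_mem (add_mem ?_ ?_) ?_) ?_) ?_ <;>
    exact Submodule.smul_mem _ _ (Submodule.subset_span (by simp))
  · rw [Submodule.span_le]
    rintro _ (rfl | rfl | rfl | rfl | rfl)
    exacts [⟨![1, 0, 0, 0, 0], by simp [affineMap_eq, axialTranslation]⟩,
      ⟨![0, 1, 0, 0, 0], by simp [affineMap_eq, axialTranslation]⟩,
      ⟨![0, 0, 1, 0, 0], by simp [affineMap_eq, axialTranslation]⟩,
      ⟨![0, 0, 0, 1, 0], by simp [affineMap_eq, axialTranslation]⟩,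
      ⟨![0, 0, 0, 0, 1], by simp [affineMap_eq, axialTranslation]⟩]

theorem hasFDerivAt_affine (a b e : ℝ) (p : Ext) :
    HasFDerivAt (fun q : Ext => a * q.1 + b * q.2 2 + e)
      (a • ContinuousLinearMap.fst ℝ ℝ Coord +
        b • (ContinuousLinearMap.proj (R := ℝ) (φ := fun _ : Fin 3 => ℝ) 2).comp
          (ContinuousLinearMap.snd ℝ ℝ Coord)) p :=
  (ContinuousLinearMap.hasFDerivAt (a • ContinuousLinearMap.fst ℝ ℝ Coord +
        b • (ContinuousLinearMap.proj (R := ℝ) (φ := fun _ : Fin 3 => ℝ) 2).comp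
          (ContinuousLinearMap.snd ℝ ℝ Coord))).add_const e

theorem dirDeriv_of_eqOn_affine {F : Ext → ℝ} {a b e : ℝ}
    (h : ∀ q ∈ D, F q = a * q.1 + b * q.2 2 + e) {p : Ext} (hp : p ∈ D) (u : Ext) :
    dirDeriv u F p = a * u.1 + b * u.2 2 := by
  rw [dirDeriv_congr h hp, dirDeriv, (hasFDerivAt_affine a b e p).fderiv]
  simp

theorem dirDeriv_dirDeriv_of_eqOn_affine {F : Ext → ℝ} {a b e : ℝ}
    (h : ∀ q ∈ D, F q = a * q.1 + b * q.2 2 + e) {p : Ext} (hp : p ∈ D) (u w : Ext) :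
    dirDeriv u (dirDeriv w F) p = 0 := by
  rw [dirDeriv_congr (fun q hq => dirDeriv_of_eqOn_affine h hq w) hp, dirDeriv_const]

theorem sComp_affineMap (k : Fin 7 → ℝ) :
    ∀ p ∈ D, (affineMap D k).sComp p = k 1 * p.1 + k 2 * p.2 2 + k 3 := fun p hp => by
  rw [VField.sComp, toFun_affineMap k hp, affineField]

theorem xComp_zero_affineMap (k : Fin 7 → ℝ) :
    ∀ p ∈ D, (affineMap D k).xComp 0 p = 0 * p.1 + 0 * p.2 2 + 0 := fun p hp => by
  simp [VField.xComp, toFun_affineMap k hp, affineField]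

theorem xComp_one_affineMap (k : Fin 7 → ℝ) :
    ∀ p ∈ D, (affineMap D k).xComp 1 p = 0 * p.1 + 0 * p.2 2 + k 0 := fun p hp => by
  simp [VField.xComp, toFun_affineMap k hp, affineField]

theorem xComp_two_affineMap (k : Fin 7 → ℝ) :
    ∀ p ∈ D, (affineMap D k).xComp 2 p = k 4 * p.1 + k 5 * p.2 2 + k 6 := fun p hp => by
  simp [VField.xComp, toFun_affineMap k hp, affineField]

/-- The coefficients are read off at a single point of D: the linear ones from first derivatives,
which make sense because D is open, and the constant ones from the values. -/
theorem affineMap_injective (hne : (D : Set Ext).Nonempty) :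
    Function.Injective (affineMap D) := by
  rw [← LinearMap.ker_eq_bot, LinearMap.ker_eq_bot']
  intro k hk
  obtain ⟨p, hp⟩ := hne
  have z : ∀ q ∈ D, (affineMap D k).sComp q = 0 ∧ ∀ i, (affineMap D k).xComp i q = 0 :=
    fun q hq => by simp [VField.sComp, VField.xComp, hk, VField.toFun_zero]
  have h1 := dirDeriv_of_eqOn_affine (sComp_affineMap k) hp eS
  have h2 := dirDeriv_of_eqOn_affine (sComp_affineMap k) hp (eX 2)
  have h4 := dirDeriv_of_eqOn_affine (xComp_two_affineMap k) hp eS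
  have h5 := dirDeriv_of_eqOn_affine (xComp_two_affineMap k) hp (eX 2)
  have h0 := xComp_one_affineMap k p hp
  have h3 := sComp_affineMap k p hp
  have h6 := xComp_two_affineMap k p hp
  rw [dirDeriv_eq_zero_of_eqOn (fun q hq => (z q hq).1) hp] at h1 h2
  rw [dirDeriv_eq_zero_of_eqOn (fun q hq => (z q hq).2 2) hp] at h4 h5
  rw [(z p hp).2] at h0 h6
  rw [(z p hp).1] at h3
  simp [eS, eX] at h1 h2 h4 h5
  rw [← h1, ← h2] at h3
  rw [← h4, ← h5] at h6
  ext i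
  fin_cases i <;> simp <;> linarith

theorem isPointSymmetry_affineMap (hc : 0 < c) (hD : ∀ p ∈ D, 0 < p.2 0 ∧ |ω| * p.2 0 < c)
    (k : Fin 7 → ℝ) : IsPointSymmetry (spatialMetric c ω) (affineMap D k) := by
  rw [isPointSymmetry_iff hc hD]
  intro p hp v
  simp only [DeterminingEqs, geodesicDeriv2_eq ((affineMap D k).smoothOn_xComp _) hp,
    geodesicDeriv2_eq (affineMap D k).smoothOn_sComp hp, fderiv_apply_ext,
    dirDeriv_of_eqOn_affine (sComp_affineMap k) hp,
    dirDeriv_of_eqOn_affine (xComp_zero_affineMap k) hp,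
    dirDeriv_of_eqOn_affine (xComp_one_affineMap k) hp,
    dirDeriv_of_eqOn_affine (xComp_two_affineMap k) hp,
    dirDeriv_dirDeriv_of_eqOn_affine (sComp_affineMap k) hp,
    dirDeriv_dirDeriv_of_eqOn_affine (xComp_zero_affineMap k) hp,
    dirDeriv_dirDeriv_of_eqOn_affine (xComp_one_affineMap k) hp,
    dirDeriv_dirDeriv_of_eqOn_affine (xComp_two_affineMap k) hp, xComp_zero_affineMap k p hp]
  simp [eX]

theorem isPointSymmetry_iff_mem_range (hc : 0 < c) (hω : ω ≠ 0)
    (hconn : IsConnected (D : Set Ext)) (hD : ∀ p ∈ D, 0 < p.2 0 ∧ |ω| * p.2 0 < c)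
    (X : VField D) :
    IsPointSymmetry (spatialMetric c ω) X ↔ X ∈ LinearMap.range (affineMap D) := by
  constructor
  · intro hX
    obtain ⟨k, hk⟩ := exists_affineField hc hω hconn hD hX
    exact ⟨k, VField.eq_of_eqOn fun p hp => by rw [toFun_affineMap k hp, hk p hp]⟩
  · rintro ⟨k, rfl⟩
    exact isPointSymmetry_affineMap hc hD k

theorem fderiv_affineMap (k : Fin 7 → ℝ) {p : Ext} (hp : p ∈ D) (u : Ext) :
    fderiv ℝ (affineMap D k).toFun p u =
      (k 1 * u.1 + k 2 * u.2 2, ![0, 0, k 4 * u.1 + k 5 * u.2 2]) := by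
  have hd : HasFDerivAt (affineMap D k).toFun _ p :=
    ((affineMap D k).differentiableAt hp).hasFDerivAt
  have h1 : ∀ u, dirDeriv u (affineMap D k).sComp p =
      (fderiv ℝ (affineMap D k).toFun p u).1 := fun u => by
    have h : HasFDerivAt (affineMap D k).sComp _ p := hd.fst
    rw [dirDeriv, h.fderiv]
    rfl
  have h2 : ∀ i u, dirDeriv u ((affineMap D k).xComp i) p =
      (fderiv ℝ (affineMap D k).toFun p u).2 i := fun i u => by
    have h : HasFDerivAt ((affineMap D k).xComp i) _ p := hasFDerivAt_pi'.1 hd.snd i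
    rw [dirDeriv, h.fderiv]
    rfl
  refine Prod.ext ?_ (funext fun i => ?_)
  · rw [← h1, dirDeriv_of_eqOn_affine (sComp_affineMap k) hp]
  · rw [← h2]
    fin_cases i
    · simp [dirDeriv_of_eqOn_affine (xComp_zero_affineMap k) hp]
    · simp [dirDeriv_of_eqOn_affine (xComp_one_affineMap k) hp]
    · simp [dirDeriv_of_eqOn_affine (xComp_two_affineMap k) hp]

theorem lie_affineMap (k l : Fin 7 → ℝ) :
    ⁅affineMap D k, affineMap D l⁆ = affineMap D (affineBracket k l) := by
  refine VField.eq_of_eqOn fun p hp => ?_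
  rw [VField.toFun_lie, VectorField.lieBracket, fderiv_affineMap l hp, fderiv_affineMap k hp,
    toFun_affineMap _ hp, toFun_affineMap _ hp, toFun_affineMap _ hp]
  refine Prod.ext ?_ (funext fun i => ?_)
  · simp [affineField, affineBracket]
    ring
  · fin_cases i <;> simp [affineField, affineBracket]
    ring

/-! ### The variational symmetries -/

theorem arcLength_spatialMetric (J : Jet1) :
    arcLength (spatialMetric c ω) J = Real.sqrt (J.2.2 0 * J.2.2 0 +
      J.2.1 0 ^ 2 / (1 - ω ^ 2 * J.2.1 0 ^ 2 / c ^ 2) * (J.2.2 1 * J.2.2 1) +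
      J.2.2 2 * J.2.2 2) := by
  simp [arcLength, spatialMetric, Fin.sum_univ_three, Matrix.diagonal_apply, mul_assoc]

/-- The arc length is homogeneous of degree one in the velocity, so the reparametrization part of
the prolongation contributes minus arc length times the total derivative of Σ and cancels the second
term. There is no radial component, the φ component is constant, and the arc length does not depend
on φ or z; only the pairing of ż with the total derivative of Z survives, divided by the length ℓ.
-/
theorem isVariationalSymmetry_affineMap_iff (hc : 0 < c) (hne : (D : Set Ext).Nonempty)
    (hD : ∀ p ∈ D, 0 < p.2 0 ∧ |ω| * p.2 0 < c) (k : Fin 7 → ℝ) :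
    IsVariationalSymmetry (spatialMetric c ω) (affineMap D k) ↔ k 4 = 0 ∧ k 5 = 0 := by
  have key : ∀ (s : ℝ) (x v : Coord), (s, x) ∈ D → v ≠ 0 →
      ∃ ℓ, 0 < ℓ ∧ fderiv ℝ (arcLength (spatialMetric c ω)) (s, x, v)
        (prolong1 (affineMap D k).toFun (s, x, v)) + arcLength (spatialMetric c ω) (s, x, v) *
          totalDeriv (affineMap D k).sComp (s, x, v) = v 2 * (k 4 + k 5 * v 2) / ℓ := by
    intro s x v hp hv
    obtain ⟨h0, h1⟩ := hD _ hp
    have hm := sq_sub_pos h0 h1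
    dsimp only at h0 h1 hm
    let H : ℝ → ℝ := fun r => r ^ 2 / (1 - ω ^ 2 * r ^ 2 / c ^ 2)
    have hn : 0 < 1 - ω ^ 2 * x 0 ^ 2 / c ^ 2 := by
      have : 1 - ω ^ 2 * x 0 ^ 2 / c ^ 2 = (c ^ 2 - ω ^ 2 * x 0 ^ 2) / c ^ 2 := by field_simp
      rw [this]
      positivity
    have hH : 0 < H (x 0) := by
      simp only [H]
      positivity
    have dH : HasDerivAt H (deriv H (x 0)) (x 0) := by
      refine DifferentiableAt.hasDerivAt ?_
      exact DifferentiableAt.fun_div (by fun_prop) (by fun_prop) hn.ne'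
    let X : Jet1 →L[ℝ] ℝ := (ContinuousLinearMap.proj (R := ℝ) (φ := fun _ : Fin 3 => ℝ) 0).comp
      ((ContinuousLinearMap.fst ℝ Coord Coord).comp (ContinuousLinearMap.snd ℝ ℝ _))
    let V : Fin 3 → Jet1 →L[ℝ] ℝ := fun i =>
      (ContinuousLinearMap.proj (R := ℝ) (φ := fun _ : Fin 3 => ℝ) i).comp
        ((ContinuousLinearMap.snd ℝ Coord Coord).comp (ContinuousLinearMap.snd ℝ ℝ _))
    have hV := fun i => (V i).hasFDerivAt (x := (s, x, v))
    have hHX := HasDerivAt.comp_hasFDerivAt (h₂ := H) (f := X) (s, x, v) dH X.hasFDerivAt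
    have hG := (((hV 0).fun_mul (hV 0)).fun_add (hHX.fun_mul ((hV 1).fun_mul (hV 1)))).fun_add
      ((hV 2).fun_mul (hV 2))
    have pos : 0 < v 0 * v 0 + H (x 0) * (v 1 * v 1) + v 2 * v 2 := by
      by_contra hle
      have h3 := mul_self_nonneg (v 0)
      have h4 := mul_self_nonneg (v 2)
      have h5 := mul_nonneg hH.le (mul_self_nonneg (v 1))
      have e0 : v 0 * v 0 = 0 := by linarith
      have e2 : v 2 * v 2 = 0 := by linarith
      have e1 : H (x 0) * (v 1 * v 1) = 0 := by linarith
      refine hv (funext fun i => ?_)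
      fin_cases i
      · exact mul_self_eq_zero.1 e0
      · exact mul_self_eq_zero.1 ((mul_eq_zero.1 e1).resolve_left hH.ne')
      · exact mul_self_eq_zero.1 e2
    have hL := hG.sqrt pos.ne'
    have e : arcLength (spatialMetric c ω) = fun J : Jet1 => Real.sqrt
        (V 0 J * V 0 J + (H ∘ X) J * (V 1 J * V 1 J) + V 2 J * V 2 J) :=
      funext fun J => arcLength_spatialMetric J
    have hd : ∀ F : Ext → ℝ, totalDeriv F (s, x, v) = dirDeriv (1, v) F (s, x) := fun _ => rfl
    have eτ : totalDeriv (affineMap D k).sComp (s, x, v) = k 1 + k 2 * v 2 := by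
      rw [hd, dirDeriv_of_eqOn_affine (sComp_affineMap k) hp, mul_one]
    have ex : (prolong1 (affineMap D k).toFun (s, x, v)).2.1 0 = 0 :=
      (xComp_zero_affineMap k _ hp).trans (by simp)
    have ev0 : (prolong1 (affineMap D k).toFun (s, x, v)).2.2 0 = -(k 1 + k 2 * v 2) * v 0 := by
      change totalDeriv ((affineMap D k).xComp 0) (s, x, v) -
        totalDeriv (affineMap D k).sComp (s, x, v) * v 0 = _
      rw [eτ, hd, dirDeriv_of_eqOn_affine (xComp_zero_affineMap k) hp]
      ring
    have ev1 : (prolong1 (affineMap D k).toFun (s, x, v)).2.2 1 = -(k 1 + k 2 * v 2) * v 1 := by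
      change totalDeriv ((affineMap D k).xComp 1) (s, x, v) -
        totalDeriv (affineMap D k).sComp (s, x, v) * v 1 = _
      rw [eτ, hd, dirDeriv_of_eqOn_affine (xComp_one_affineMap k) hp]
      ring
    have ev2 : (prolong1 (affineMap D k).toFun (s, x, v)).2.2 2 =
        k 4 + k 5 * v 2 - (k 1 + k 2 * v 2) * v 2 := by
      change totalDeriv ((affineMap D k).xComp 2) (s, x, v) -
        totalDeriv (affineMap D k).sComp (s, x, v) * v 2 = _
      rw [eτ, hd, dirDeriv_of_eqOn_affine (xComp_two_affineMap k) hp, mul_one]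
    have hsq := Real.mul_self_sqrt pos.le
    have hsp := Real.sqrt_pos.2 pos
    refine ⟨Real.sqrt (v 0 * v 0 + H (x 0) * (v 1 * v 1) + v 2 * v 2), hsp, ?_⟩
    have eL : arcLength (spatialMetric c ω) (s, x, v) =
        Real.sqrt (v 0 * v 0 + H (x 0) * (v 1 * v 1) + v 2 * v 2) := arcLength_spatialMetric _
    rw [eτ, eL, e, hL.fderiv]
    simp only [V, X, Function.comp_apply, ContinuousLinearMap.comp_apply, add_apply, smul_apply,
      smul_eq_mul, ContinuousLinearMap.proj_apply, ContinuousLinearMap.coe_snd',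
      ContinuousLinearMap.coe_fst', ex, ev0, ev1, ev2]
    set ℓ := Real.sqrt (v 0 * v 0 + H (x 0) * (v 1 * v 1) + v 2 * v 2)
    field_simp
    -- Replacing ℓ² by the radicand realizes this homogeneity: the terms with k 1 + k 2 ż cancel.
    linear_combination (k 1 + k 2 * v 2) * 2 * hsq
  constructor
  · intro h
    obtain ⟨⟨s, x⟩, hp⟩ := hne
    -- The velocities ż = 1 and ż = -1 along the axis give k 4 + k 5 = 0 and k 4 - k 5 = 0.
    have n1 : (![0, 0, 1] : Coord) ≠ 0 := fun e => by simpa using congrFun e 2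
    have n2 : (![0, 0, -1] : Coord) ≠ 0 := fun e => by simpa using congrFun e 2
    obtain ⟨ℓ₁, p1, e1⟩ := key s x _ hp n1
    obtain ⟨ℓ₂, p2, e2⟩ := key s x _ hp n2
    have f1 := e1.symm.trans (h (s, x, ![0, 0, 1]) hp n1)
    have f2 := e2.symm.trans (h (s, x, ![0, 0, -1]) hp n2)
    simp [p1.ne', p2.ne'] at f1 f2
    constructor <;> linarith
  · rintro ⟨h4, h5⟩ ⟨s, x, v⟩ hp hv
    obtain ⟨ℓ, -, e⟩ := key s x v hp hv
    exact e.trans (by simp [h4, h5])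

end AffineFields

end RotatingSpace

/-! ### Assembly: both algebras as images of coefficient spaces. -/

open RotatingSpace in
theorem mainTheorem1 (c ω : ℝ) (hc : 0 < c) (hω : ω ≠ 0)
    (D : TopologicalSpace.Opens Ext) (hconn : IsConnected (D : Set Ext))
    (hD : ∀ p ∈ D, 0 < p.2 0 ∧ |ω| * p.2 0 < c) :
    ∃ g gv : LieSubalgebra ℝ (VField D),
      -- the Lie point symmetries of the geodesic equations
      (∀ X : VField D, X ∈ g ↔ IsPointSymmetry (spatialMetric c ω) X) ∧
      g.toSubmodule = Submodule.span ℝ {dPhi D, sDs D, zDs D, dS D, sDz D, zDz D, dZ D} ∧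
      Module.finrank ℝ g = 7 ∧
      Module.finrank ℝ (LieAlgebra.derivedSeries ℝ g 1) = 5 ∧
      ⁅LieAlgebra.derivedSeries ℝ g 1, LieAlgebra.derivedSeries ℝ g 1⁆ =
        LieAlgebra.derivedSeries ℝ g 1 ∧
      ¬ LieAlgebra.IsSolvable g ∧
      ¬ LieRing.IsNilpotent g ∧
      -- the variational ones among them
      gv ≤ g ∧
      (∀ X : VField D, X ∈ gv ↔ X ∈ g ∧ IsVariationalSymmetry (spatialMetric c ω) X) ∧
      gv.toSubmodule = Submodule.span ℝ {dPhi D, sDs D, zDs D, dS D, dZ D} ∧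
      Module.finrank ℝ gv = 5 ∧
      LieAlgebra.IsSolvable gv ∧
      ¬ LieRing.IsNilpotent gv := by
  have inj := affineMap_injective hconn.nonempty
  have inj' : Function.Injective (affineMap D ∘ₗ axialTranslation) :=
    inj.comp axialTranslation_injective
  let g : LieSubalgebra ℝ (VField D) :=
    { LinearMap.range (affineMap D) with
      lie_mem' := by
        rintro _ _ ⟨k, rfl⟩ ⟨l, rfl⟩
        exact ⟨_, (lie_affineMap k l).symm⟩ }
  have lie' : ∀ k l, ⁅(affineMap D ∘ₗ axialTranslation) k, (affineMap D ∘ₗ axialTranslation) l⁆ =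
      (affineMap D ∘ₗ axialTranslation) (axialBracket k l) := fun k l =>
    (lie_affineMap _ _).trans (congrArg _ (affineBracket_axialTranslation k l))
  let gv : LieSubalgebra ℝ (VField D) :=
    { LinearMap.range (affineMap D ∘ₗ axialTranslation) with
      lie_mem' := by
        rintro _ _ ⟨k, rfl⟩ ⟨l, rfl⟩
        exact ⟨_, (lie' k l).symm⟩ }
  let e : (Fin 7 → ℝ) ≃ₗ[ℝ] g := LinearEquiv.ofInjective (affineMap D) inj
  let e' : (Fin 5 → ℝ) ≃ₗ[ℝ] gv := LinearEquiv.ofInjective (affineMap D ∘ₗ axialTranslation) inj'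
  have he : ∀ k l, ⁅e k, e l⁆ = e (affineBracket k l) := fun k l =>
    Subtype.ext (lie_affineMap k l)
  have he' : ∀ k l, ⁅e' k, e' l⁆ = e' (axialBracket k l) := fun k l => Subtype.ext (lie' k l)
  obtain ⟨d1, d2, d3, d4⟩ := affine_structure e he
  obtain ⟨a1, a2⟩ := axial_structure e' he'
  have hle : gv ≤ g := by
    rintro _ ⟨k, rfl⟩
    exact ⟨_, rfl⟩
  refine ⟨g, gv, fun X => (isPointSymmetry_iff_mem_range hc hω hconn hD X).symm, range_affineMap,
    by rw [← e.finrank_eq, Module.finrank_fin_fun], d1, d2, d3, d4, hle, fun X => ⟨fun hX => ?_, ?_⟩,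
    range_affineMap_axialTranslation, by rw [← e'.finrank_eq, Module.finrank_fin_fun], a1, a2⟩
  · refine ⟨hle hX, ?_⟩
    obtain ⟨k, rfl⟩ := hX
    exact (isVariationalSymmetry_affineMap_iff hc hconn.nonempty hD _).2 ⟨rfl, rfl⟩
  · rintro ⟨⟨k, rfl⟩, hV⟩
    obtain ⟨h4, h5⟩ := (isVariationalSymmetry_affineMap_iff hc hconn.nonempty hD k).1 hV
    refine ⟨![k 0, k 1, k 2, k 3, k 6], congrArg (affineMap D) (funext fun i => ?_)⟩
    fin_cases i <;> simp [axialTranslation, h4, h5]
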